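/- Let $k\ge 3$, let $G=(V(G),E(G))$ be a finite connected $k$-uniform hypergraph (edges are $k$-element subsets of $V(G)$) with at least two edges, and let $0\le\alpha<1$. The degree $d_x$ of a vertex $x$ is the number of edges containing it; a vertex of degree one is pendant, and an edge is pendant if all its vertices, except at most one, have degree one. For a $k$-uniform hypergraph $H$ on a finite vertex set, let $\mathcal A(H)$ be the order-$k$ tensor indexed by $V(H)$ whose entry at $(i_1,\dots,i_k)$ is $\frac1{(k-1)!}$ if $\{i_1,\dots,i_k\}\in E(H)$ and $0$ otherwise, let $\mathcal D(H)$ be the diagonal order-$k$ tensor whose $i$-th diagonal entry is $d_i$, and let $\mathcal A_\alpha(H)=\alpha\mathcal D(H)+(1-\alpha)\mathcal A(H)$. The $\alpha$-spectral radius $\rho_\alpha(H)$ is the largest modulus of an eigenvalue of $\mathcal A_\alpha(H)$, where $\lambda\in\mathbb C$ is an eigenvalue of a tensor $\mathcal T=(t_{i_1\cdots i_k})$ if there is a nonzero complex vector $x$ with $\sum_{i_2,\dots,i_k}t_{i i_2\cdots i_k}x_{i_2}\cdots x_{i_k}=\lambda x_i^{k-1}$ for all $i$. For vertices $u,v$ of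 $G$ and integers $p,q\ge 0$, let $G_{u,v}(p,q)$ be the $k$-uniform hypergraph obtained from $G$ by attaching at $u$ a loose path with $p$ edges and at $v$ a loose path with $q$ edges: each attached path consists of $k$-element edges $e_1,e_2,\dots$ in which consecutive edges share exactly one vertex and other pairs of edges are disjoint, its starting vertex (a vertex of $e_1$ that is not in $e_2$) is $u$, respectively $v$, and all of its other vertices are new (a path with $0$ edges adds nothing). Let $u\ne v$ be two pendant vertices in the same pendant edge $e$ of $G$. If $p\ge q\ge 1$, then $$\rho_\alpha(G_{u,v}(p,q))>\rho_\alpha(G_{u,v}(p+1,q-1)).$$ -/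

import Mathlib

open scoped ENNReal

noncomputable section

/-- A real tensor (hypermatrix) of order `k` with index set `ι`. The first index is separated from
the remaining `k - 1` ones: for `k ≥ 1`, `A i j` is the entry `a_{i, j_1, …, j_{k-1}}`. -/
abbrev RealTensor (k : ℕ) (ι : Type*) : Type _ := ι → (Fin (k - 1) → ι) → ℝ

namespace RealTensor

variable {k : ℕ} {ι : Type*}

/-- The vector `A x` with coordinates `∑_{j_1, …, j_{k-1}} a_{i, j_1, …, j_{k-1}} x_{j_1} ⋯ x_{j_{k-1}}`.
The index set is always finite in use, so that `∑ᶠ` is an ordinary finite sum. -/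
def apply (A : RealTensor k ι) (x : ι → ℂ) (i : ι) : ℂ :=
  ∑ᶠ j : Fin (k - 1) → ι, (A i j : ℂ) * ∏ t, x (j t)

/-- `μ` is an eigenvalue of `A` if `A x = μ x^{[k-1]}` for some nonzero complex vector `x`. -/
def IsEigenvalue (A : RealTensor k ι) (μ : ℂ) : Prop :=
  ∃ x : ι → ℂ, x ≠ 0 ∧ ∀ i, A.apply x i = μ * x i ^ (k - 1)

/-- The spectral radius: the largest modulus of an eigenvalue, as an extended nonnegative real
(the convention of `spectralRadius`, so that no default value of a supremum interferes). -/
def specRadius (A : RealTensor k ι) : ℝ≥0∞ :=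
  ⨆ μ ∈ {μ : ℂ | A.IsEigenvalue μ}, ‖μ‖ₑ

end RealTensor

namespace Hypergraph

variable {V : Type*}

/-- Every edge has exactly `k` vertices. -/
def IsUniform (H : Hypergraph V) (k : ℕ) : Prop := ∀ e ∈ H.edgeSet, e.ncard = k

/-- There is a vertex, and any two vertices are joined by a sequence of consecutively adjacent
vertices. -/
def IsConnected (H : Hypergraph V) : Prop :=
  H.vertexSet.Nonempty ∧
    ∀ x ∈ H.vertexSet, ∀ y ∈ H.vertexSet, Relation.ReflTransGen H.Adj x y

/-- The number of edges that contain `x`. -/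
def degree (H : Hypergraph V) (x : V) : ℕ := {e ∈ H.edgeSet | x ∈ e}.ncard

/-- A vertex of degree one. -/
def IsPendantVertex (H : Hypergraph V) (x : V) : Prop := x ∈ H.vertexSet ∧ H.degree x = 1

/-- An edge all of whose vertices, except at most one, have degree one. -/
def IsPendantEdge (H : Hypergraph V) (e : Set V) : Prop :=
  e ∈ H.edgeSet ∧ {x ∈ e | H.degree x ≠ 1}.Subsingleton

open Classical in
/-- The adjacency tensor of order `k`: the entry at `(i_1, …, i_k)` is `1 / (k - 1)!` if
`{i_1, …, i_k}` is an edge, and `0` otherwise. -/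
def adjacencyTensor (H : Hypergraph V) (k : ℕ) : RealTensor k H.vertexSet := fun i j =>
  if insert (i : V) (Set.range fun t => (j t : V)) ∈ H.edgeSet
    then 1 / ((k - 1).factorial : ℝ) else 0

open Classical in
/-- The degree tensor of order `k`: diagonal, with the degree of `i` at `(i, …, i)`. -/
def degreeTensor (H : Hypergraph V) (k : ℕ) : RealTensor k H.vertexSet := fun i j =>
  if ∀ t, j t = i then (H.degree i : ℝ) else 0

/-- The tensor `α D(H) + (1 - α) A(H)`. -/
def alphaTensor (H : Hypergraph V) (k : ℕ) (α : ℝ) : RealTensor k H.vertexSet := fun i j =>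
  α * H.degreeTensor k i j + (1 - α) * H.adjacencyTensor k i j

/-- The `α`-spectral radius of a `k`-uniform hypergraph. -/
def alphaSpectralRadius (H : Hypergraph V) (k : ℕ) (α : ℝ) : ℝ≥0∞ :=
  (H.alphaTensor k α).specRadius

/-- The new vertices of a loose path of `p` edges of size `k` that is attached at one of its ends:
`(i, none)` is the vertex that ends the `i`-th edge (and lies on the next edge, if there is one),
and `(i, some c)` are the `k - 2` further vertices of the `i`-th edge. -/
abbrev PathVertex (k p : ℕ) : Type := Fin p × Option (Fin (k - 2))

/-- The vertex at which the `i`-th edge of a path attached at `u` starts: `u` itself for the first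
edge, the end of the preceding edge for the others. -/
def pathStart (k : ℕ) (u : V) {p : ℕ} (i : Fin p) : V ⊕ PathVertex k p :=
  if (i : ℕ) = 0 then Sum.inl u else Sum.inr (⟨(i : ℕ) - 1, by omega⟩, none)

/-- The `i`-th edge of a path attached at `u`. -/
def pathEdge (k : ℕ) (u : V) {p : ℕ} (i : Fin p) : Set (V ⊕ PathVertex k p) :=
  insert (pathStart k u i) (Set.range fun c => Sum.inr (i, c))

/-- The hypergraph obtained from `H` by attaching at the vertex `u` a pendant loose path with `p`
edges of size `k`; all vertices of the path other than `u` are new. (For a vertex `u` of `H` the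
`insert` has no effect.) -/
def attachPath (H : Hypergraph V) (k : ℕ) (u : V) (p : ℕ) : Hypergraph (V ⊕ PathVertex k p) where
  vertexSet := Sum.inl '' insert u H.vertexSet ∪ Set.range Sum.inr
  edgeSet := Set.image Sum.inl '' H.edgeSet ∪ Set.range (pathEdge k u)
  subset_vertexSet_of_mem_edgeSet' := by
    rintro _ (⟨e, he, rfl⟩ | ⟨i, rfl⟩)
    · rintro _ ⟨x, hx, rfl⟩
      exact Or.inl ⟨x, Or.inr (H.subset_vertexSet_of_mem_edgeSet' he hx), rfl⟩
    · rintro x (rfl | ⟨c, rfl⟩)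
      · unfold pathStart
        split_ifs
        · exact Or.inl ⟨u, Or.inl rfl, rfl⟩
        · exact Or.inr ⟨_, rfl⟩
      · exact Or.inr ⟨_, rfl⟩

/-- The hypergraph `G_{u,v}(p,q)`: a pendant loose path with `p` edges is attached at `u`, and one
with `q` edges at `v`. -/
def attachPaths (G : Hypergraph V) (k : ℕ) (u v : V) (p q : ℕ) :
    Hypergraph ((V ⊕ PathVertex k p) ⊕ PathVertex k q) :=
  (G.attachPath k u p).attachPath k (Sum.inl v) q

end Hypergraph

end

/-! For nonnegative `x` let `F(x)` be the sum over the edges of `α ∑ x_i ^ k + (1 - α) k ∏ x_i`. By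
compactness `F(x) / ∑ x_i ^ k` has a maximum `c`. A maximizer satisfies the eigenvalue equations,
and the moduli of the coordinates of any eigenvector show that no eigenvalue exceeds `c` in modulus,
so `c` is the spectral radius (`Represents.alphaSpectralRadius_eq`). In the connected case
maximizers are positive (`IsFormBound.pos`). It remains to compare two maxima.

Let `q = r + 1`, and take a positive maximizer for the hypergraph with paths of `p + 1` and `r`
edges. Two arms start at `u`: the attached path with values `a` (`p + 1` edges), and the pendant
edge followed by the path at `v`, with values `b` (`r + 1` edges). The rest of the hypergraph hangs
on the first edge of the second arm. Replace `a` and `b` by `M = max a b` and `m = min a b`, giving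
`M` to the arm that carries the rest. With `M` on `p + 1` edges and `m` on `r + 1` edges this is a
vector on the hypergraph with paths of `p` and `r + 1` edges, where `v` has taken over the role of
`u` as the common start. The sum of `k`-th powers is unchanged, the arms do not lose
(`arms_le_max_min`), and the rest only sees larger values. Hence the new maximum `c'` is at least
`c`.

If `c' = c`, the new vector is a maximizer too. A vertex of the pendant edge that lies on another
edge keeps its value; comparing the two eigenvalue equations there, and then along the arm, forces
`b = M` up to the end of `b`. There the old equation stops, while the new one has another positive
term because `r < p`: a contradiction (`lt_of_isFormBound_twoArms`). -/

/-- The contribution of the edge `s` to the homogeneous form of the `α`-tensor. -/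
def edgeForm {ι : Type*} (α : ℝ) (k : ℕ) (x : ι → ℝ) (s : Finset ι) : ℝ :=
  α * ∑ i ∈ s, x i ^ k + (1 - α) * k * ∏ i ∈ s, x i

/-- The homogeneous form `∑ x_{i_1} t_{i_1 ⋯ i_k} ⋯ x_{i_k}` of the `α`-tensor of the
hypergraph with edges `E e`. -/
def edgesForm {ι ε : Type*} [Fintype ε] (E : ε → Finset ι) (α : ℝ) (k : ℕ) (x : ι → ℝ) : ℝ :=
  ∑ e, edgeForm α k x (E e)

/-- On nonnegative vectors the form is at most `c` times `∑ x_i ^ k`. -/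
def IsFormBound {ι ε : Type*} [Fintype ι] [Fintype ε] (E : ε → Finset ι) (α : ℝ) (k : ℕ)
    (c : ℝ) : Prop :=
  ∀ x : ι → ℝ, (∀ i, 0 ≤ x i) → edgesForm E α k x ≤ c * ∑ i, x i ^ k

/-- A set of vertices that contains every edge it meets is empty or everything. -/
def EdgesConnected {ι ε : Type*} (E : ε → Finset ι) : Prop :=
  ∀ S : Set ι, S.Nonempty → (∀ e, ∀ i ∈ E e, i ∈ S → ∀ j ∈ E e, j ∈ S) → ∀ i, i ∈ S

/-! ### The homogeneous form, its maximum and its maximizers -/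

section Form

variable {ι ε : Type*} {E : ε → Finset ι} {α : ℝ} {k : ℕ}

theorem edgeForm_mono (hα0 : 0 ≤ α) (hα1 : α ≤ 1) {x y : ι → ℝ} {s : Finset ι}
    (hx : ∀ i ∈ s, 0 ≤ x i) (hxy : ∀ i ∈ s, x i ≤ y i) :
    edgeForm α k x s ≤ edgeForm α k y s := by
  have h1 : ∑ i ∈ s, x i ^ k ≤ ∑ i ∈ s, y i ^ k :=
    Finset.sum_le_sum fun i hi => pow_le_pow_left₀ (hx i hi) (hxy i hi) k
  have h2 : ∏ i ∈ s, x i ≤ ∏ i ∈ s, y i := Finset.prod_le_prod hx hxy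
  have h3 : 0 ≤ (1 - α) * k := mul_nonneg (by linarith) (Nat.cast_nonneg k)
  exact add_le_add (mul_le_mul_of_nonneg_left h1 hα0) (mul_le_mul_of_nonneg_left h2 h3)

theorem edgeForm_smul {s : Finset ι} (hs : s.card = k) (t : ℝ) (x : ι → ℝ) :
    edgeForm α k (fun i => t * x i) s = t ^ k * edgeForm α k x s := by
  simp only [edgeForm, mul_pow, ← Finset.mul_sum, Finset.prod_mul_distrib, Finset.prod_const, hs]
  ring

theorem edgesForm_smul [Fintype ε] (hE : ∀ e, (E e).card = k) (t : ℝ) (x : ι → ℝ) :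
    edgesForm E α k (fun i => t * x i) = t ^ k * edgesForm E α k x := by
  simp only [edgesForm, edgeForm_smul (hE _), Finset.mul_sum]

theorem edgesForm_nonneg [Fintype ε] (hα0 : 0 ≤ α) (hα1 : α ≤ 1) {x : ι → ℝ} (hx : ∀ i, 0 ≤ x i) :
    0 ≤ edgesForm E α k x := by
  refine Finset.sum_nonneg fun e _ => add_nonneg (mul_nonneg hα0 ?_) (mul_nonneg ?_ ?_)
  · exact Finset.sum_nonneg fun i _ => pow_nonneg (hx i) k
  · exact mul_nonneg (by linarith) (Nat.cast_nonneg k)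
  · exact Finset.prod_nonneg fun i _ => hx i

theorem sum_pow_pos [Fintype ι] {x : ι → ℝ} (hx : ∀ i, 0 ≤ x i) (hx0 : x ≠ 0) : 0 < ∑ i, x i ^ k := by
  obtain ⟨i, hi⟩ := Function.ne_iff.mp hx0
  have hi' : 0 < x i := lt_of_le_of_ne (hx i) (Ne.symm hi)
  exact Finset.sum_pos' (fun j _ => pow_nonneg (hx j) k) ⟨i, Finset.mem_univ i, pow_pos hi' k⟩

theorem edgeForm_update [DecidableEq ι] (x : ι → ℝ) (i : ι) (t : ℝ) (s : Finset ι) :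
    edgeForm α k (Function.update x i t) s = edgeForm α k x s +
      if i ∈ s then α * (t ^ k - x i ^ k) + (1 - α) * k * (∏ j ∈ s.erase i, x j) * (t - x i)
      else 0 := by
  unfold edgeForm
  split_ifs with hi
  · have h1 : ∏ j ∈ s.erase i, Function.update x i t j = ∏ j ∈ s.erase i, x j :=
      Finset.prod_congr rfl fun j hj => by
        rw [Function.update_of_ne (Finset.ne_of_mem_erase hj)]
    have h2 : ∑ j ∈ s.erase i, Function.update x i t j ^ k = ∑ j ∈ s.erase i, x j ^ k :=
      Finset.sum_congr rfl fun j hj => by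
        rw [Function.update_of_ne (Finset.ne_of_mem_erase hj)]
    rw [← Finset.mul_prod_erase s _ hi, ← Finset.add_sum_erase s _ hi,
      ← Finset.mul_prod_erase s x hi, ← Finset.add_sum_erase s (fun j => x j ^ k) hi, h1, h2,
      Function.update_self]
    ring
  · have h : ∀ j ∈ s, Function.update x i t j = x j := fun j hj => by
      rw [Function.update_of_ne (ne_of_mem_of_not_mem hj hi)]
    rw [Finset.prod_congr rfl h, Finset.sum_congr rfl fun j hj => by rw [h j hj], add_zero]

variable [Fintype ι] [Fintype ε]

/-- The quotient is continuous on the nonnegative part of the unit sphere, which is compact; both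
sides are homogeneous of degree `k`, so the maximum there bounds the form on the whole orthant. -/
theorem exists_isFormBound [Nonempty ι] (hk : k ≠ 0) (hE : ∀ e, (E e).card = k)
    (hα0 : 0 ≤ α) (hα1 : α ≤ 1) :
    ∃ c : ℝ, 0 ≤ c ∧ IsFormBound E α k c ∧
      ∃ x : ι → ℝ, (∀ i, 0 ≤ x i) ∧ x ≠ 0 ∧ edgesForm E α k x = c * ∑ i, x i ^ k := by
  classical
  let K : Set (ι → ℝ) := Metric.sphere 0 1 ∩ {x | ∀ i, 0 ≤ x i}
  have hK : IsCompact K := by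
    refine (isCompact_sphere 0 1).inter_right ?_
    exact isClosed_Ici (a := (0 : ι → ℝ))
  have hKne : K.Nonempty := by
    refine ⟨fun _ => 1, ?_, fun _ => zero_le_one⟩
    simp [pi_norm_const]
  have hK0 : ∀ x ∈ K, x ≠ 0 := by
    rintro x ⟨hx, -⟩ rfl
    simp at hx
  have hcont : ContinuousOn (fun x => edgesForm E α k x / ∑ i, x i ^ k) K := by
    refine ContinuousOn.div ?_ ?_ fun x hx => (sum_pow_pos hx.2 (hK0 x hx)).ne'
    · refine Continuous.continuousOn ?_
      unfold edgesForm edgeForm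
      fun_prop
    · exact Continuous.continuousOn (by fun_prop)
  obtain ⟨x, hxK, hmax⟩ := hK.exists_isMaxOn hKne hcont
  have hxpos := sum_pow_pos (k := k) hxK.2 (hK0 x hxK)
  refine ⟨edgesForm E α k x / ∑ i, x i ^ k,
    div_nonneg (edgesForm_nonneg hα0 hα1 hxK.2) hxpos.le, ?_, x, hxK.2, hK0 x hxK,
    (div_mul_cancel₀ _ hxpos.ne').symm⟩
  intro y hy
  by_cases hy0 : y = 0
  · subst hy0
    have := edgesForm_smul (α := α) hE 0 (0 : ι → ℝ)
    simp only [Pi.zero_apply, mul_zero, zero_pow hk, zero_mul] at this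
    change edgesForm E α k (fun _ => 0) ≤ _
    simp [this, hk]
  · have hny : 0 < ‖y‖ := norm_pos_iff.mpr hy0
    have hmem : (fun i => ‖y‖⁻¹ * y i) ∈ K := by
      refine ⟨?_, fun i => mul_nonneg (inv_nonneg.mpr hny.le) (hy i)⟩
      have : (fun i => ‖y‖⁻¹ * y i) = ‖y‖⁻¹ • y := rfl
      rw [this, mem_sphere_zero_iff_norm, norm_smul, norm_inv, norm_norm,
        inv_mul_cancel₀ hny.ne']
    have hle := hmax hmem
    change edgesForm E α k (fun i => ‖y‖⁻¹ * y i) / ∑ i, (‖y‖⁻¹ * y i) ^ k ≤ _ at hle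
    rw [edgesForm_smul hE] at hle
    simp only [mul_pow, ← Finset.mul_sum] at hle
    have ht : ‖y‖⁻¹ ^ k ≠ 0 := pow_ne_zero _ (inv_ne_zero hny.ne')
    rw [mul_div_mul_left _ _ ht] at hle
    exact (div_le_iff₀ (sum_pow_pos hy hy0)).mp hle

/-- Stationarity of a one-variable maximum. For `s > 0` the derivative vanishes. At the boundary
point `s = 0` only `t > 0` is available: dividing by `t` and letting `t → 0` gives `b ≤ 0`, and the
sign condition on `b` does the rest. Thus the eigenvalue equation needs no positivity of the
maximizer. -/
theorem eq_zero_of_forall_le {n : ℕ} (hn : n ≠ 0) {a b s : ℝ} (hs : 0 ≤ s) (hb : 0 ≤ b)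
    (h : ∀ t, 0 ≤ t → a * (t ^ (n + 1) - s ^ (n + 1)) + b * ((n + 1 : ℕ) * (t - s)) ≤ 0) :
    a * s ^ n + b = 0 := by
  rcases hs.eq_or_lt with rfl | hs
  · have hlim : Filter.Tendsto (fun t : ℝ => a * t ^ n + b * (n + 1 : ℕ)) (nhdsWithin 0 (Set.Ioi 0))
        (nhds (a * 0 ^ n + b * (n + 1 : ℕ))) := by
      refine Filter.Tendsto.mono_left (Continuous.tendsto ?_ 0) nhdsWithin_le_nhds
      fun_prop
    have hle : a * 0 ^ n + b * (n + 1 : ℕ) ≤ 0 := by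
      refine le_of_tendsto hlim ?_
      filter_upwards [self_mem_nhdsWithin] with t ht
      have ht : 0 < t := ht
      have h1 := h t ht.le
      have h2 : t * (a * t ^ n + b * (n + 1 : ℕ)) ≤ 0 := by
        simp only [zero_pow (Nat.succ_ne_zero n), sub_zero, pow_succ] at h1
        linarith
      exact nonpos_of_mul_nonpos_right h2 ht
    rw [zero_pow hn, mul_zero, zero_add] at hle ⊢
    have : (0 : ℝ) < (n + 1 : ℕ) := by positivity
    exact le_antisymm (nonpos_of_mul_nonpos_left hle this) hb
  · have hder : HasDerivAt
        (fun t : ℝ => a * (t ^ (n + 1) - s ^ (n + 1)) + b * ((n + 1 : ℕ) * (t - s)))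
        (a * ((n + 1 : ℕ) * s ^ n) + b * ((n + 1 : ℕ) * 1)) s := by
      refine HasDerivAt.add (HasDerivAt.const_mul a ?_) (HasDerivAt.const_mul b ?_)
      · exact (hasDerivAt_pow (n + 1) s).sub_const _
      · exact ((hasDerivAt_id s).sub_const s).const_mul _
    have hmax : IsLocalMax
        (fun t : ℝ => a * (t ^ (n + 1) - s ^ (n + 1)) + b * ((n + 1 : ℕ) * (t - s))) s := by
      filter_upwards [lt_mem_nhds hs] with t ht
      have := h t ht.le
      simpa using this
    have h0 := hmax.hasDerivAt_eq_zero hder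
    have hn1 : ((n + 1 : ℕ) : ℝ) ≠ 0 := by positivity
    have : ((n + 1 : ℕ) : ℝ) * (a * s ^ n + b) = 0 := by linarith
    exact (mul_eq_zero.mp this).resolve_left hn1

/-- The eigenvalue equation at a vector where the bound of the form is attained. -/
theorem IsFormBound.eigen_eq [DecidableEq ι] {c : ℝ} (hc : IsFormBound E α k c) (hk : 2 ≤ k)
    (hα1 : α ≤ 1) {x : ι → ℝ} (hx : ∀ i, 0 ≤ x i)
    (hxc : edgesForm E α k x = c * ∑ i, x i ^ k) (i : ι) :
    c * x i ^ (k - 1) = ∑ e, if i ∈ E e then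
      α * x i ^ (k - 1) + (1 - α) * ∏ j ∈ (E e).erase i, x j else 0 := by
  obtain ⟨n, rfl⟩ : ∃ n, k = n + 1 := ⟨k - 1, by omega⟩
  rw [Nat.add_sub_cancel]
  set d : ℝ := ∑ e, if i ∈ E e then 1 else 0 with hd
  set b : ℝ := ∑ e, if i ∈ E e then ∏ j ∈ (E e).erase i, x j else 0 with hb
  have hb0 : 0 ≤ b := Finset.sum_nonneg fun e _ => by
    split_ifs
    · exact Finset.prod_nonneg fun j _ => hx j
    · exact le_rfl
  -- As a function of the `i`-th coordinate alone, the form minus `c ∑ x_j ^ k` is a polynomial with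
  -- these two coefficients, maximal at `x i`.
  have key : (α * d - c) * x i ^ n + (1 - α) * b = 0 := by
    refine eq_zero_of_forall_le (by omega) (hx i) (mul_nonneg (by linarith) hb0) fun t ht => ?_
    have h1 := hc (Function.update x i t) fun j => by
      rcases eq_or_ne j i with rfl | hj
      · simpa using ht
      · simpa [hj] using hx j
    have h2 : edgesForm E α (n + 1) (Function.update x i t) = edgesForm E α (n + 1) x +
        (α * d * (t ^ (n + 1) - x i ^ (n + 1)) + (1 - α) * b * ((n + 1 : ℕ) * (t - x i))) := by
      simp only [edgesForm, edgeForm_update, Finset.sum_add_distrib, hd, hb]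
      congr 1
      rw [Finset.mul_sum, Finset.mul_sum, Finset.sum_mul, Finset.sum_mul,
        ← Finset.sum_add_distrib]
      refine Finset.sum_congr rfl fun e _ => ?_
      split_ifs <;> ring
    have h3 : ∑ j, Function.update x i t j ^ (n + 1) =
        ∑ j, x j ^ (n + 1) + (t ^ (n + 1) - x i ^ (n + 1)) := by
      rw [← Finset.add_sum_erase _ _ (Finset.mem_univ i),
        ← Finset.add_sum_erase _ (fun j => x j ^ (n + 1)) (Finset.mem_univ i),
        Finset.sum_congr rfl fun j hj => by
          rw [Function.update_of_ne (Finset.ne_of_mem_erase hj)], Function.update_self]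
      ring
    rw [h2, h3, hxc] at h1
    linarith
  have h4 : (∑ e, if i ∈ E e then α * x i ^ n + (1 - α) * ∏ j ∈ (E e).erase i, x j else 0) =
      α * d * x i ^ n + (1 - α) * b := by
    simp only [hd, hb]
    rw [mul_right_comm, Finset.mul_sum, Finset.mul_sum, ← Finset.sum_add_distrib]
    refine Finset.sum_congr rfl fun e _ => ?_
    split_ifs <;> ring
  rw [h4]
  linarith

/-- The eigenvalue equation, multiplied by the coordinate. -/
theorem IsFormBound.mul_pow_eq [DecidableEq ι] {c : ℝ} (hc : IsFormBound E α k c) (hk : 2 ≤ k)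
    (hα1 : α ≤ 1) {x : ι → ℝ} (hx : ∀ i, 0 ≤ x i)
    (hxc : edgesForm E α k x = c * ∑ i, x i ^ k) (i : ι) :
    c * x i ^ k = ∑ e, if i ∈ E e then α * x i ^ k + (1 - α) * ∏ j ∈ E e, x j else 0 := by
  have h := congrArg (x i * ·) (hc.eigen_eq hk hα1 hx hxc i)
  have hpow : x i ^ k = x i * x i ^ (k - 1) := by
    rw [← pow_succ', Nat.sub_add_cancel (by omega)]
  simp only [Finset.mul_sum] at h
  rw [hpow, mul_left_comm, h]
  refine Finset.sum_congr rfl fun e _ => ?_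
  split_ifs with hi
  · rw [← Finset.mul_prod_erase _ x hi]
    ring
  · ring

/-- If `x` vanished somewhere, some edge would contain zero and nonzero values. Raising all zeros to
a small `t` adds at least a multiple of `t ^ (k - 1)` to the form, but only a multiple of `t ^ k` to
`∑ x_i ^ k`, which breaks the bound. -/
theorem IsFormBound.pos {c : ℝ} (hc : IsFormBound E α k c)
    (hE : ∀ e, (E e).card = k) (hconn : EdgesConnected E) (hα0 : 0 ≤ α) (hα1 : α < 1)
    {x : ι → ℝ} (hx : ∀ i, 0 ≤ x i) (hx0 : x ≠ 0)
    (hxc : edgesForm E α k x = c * ∑ i, x i ^ k) (i : ι) : 0 < x i := by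
  classical
  by_contra hi
  have hi : x i = 0 := le_antisymm (not_lt.mp hi) (hx i)
  obtain ⟨i₀, hi₀⟩ := Function.ne_iff.mp hx0
  obtain ⟨e, a, hae, ha, b, hbe, hb⟩ : ∃ e, ∃ a ∈ E e, x a = 0 ∧ ∃ b ∈ E e, x b ≠ 0 := by
    by_contra! hcon
    have := hconn {j | x j ≠ 0} ⟨i₀, hi₀⟩
      (fun e a ha hxa b hb hxb => hxa (hcon e b hb hxb a ha)) i
    exact this hi
  set y : ℝ → ι → ℝ := fun t j => if x j = 0 then t else x j with hy
  set P : ℝ := ∏ j ∈ E e, if x j = 0 then 1 else x j with hP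
  have hPpos : 0 < P := Finset.prod_pos fun j _ => by
    split_ifs with h
    · exact one_pos
    · exact lt_of_le_of_ne (hx j) (Ne.symm h)
  have hkpos : 0 < k := by rw [← hE e]; exact Finset.card_pos.mpr ⟨a, hae⟩
  have hprod : ∀ t, 0 ≤ t → t ≤ 1 → t ^ (k - 1) * P ≤ ∏ j ∈ E e, y t j := by
    intro t ht ht1
    have h1 : ∏ j ∈ E e, y t j = t ^ ((E e).filter fun j => x j = 0).card * P := by
      rw [hP, ← Finset.prod_const, Finset.prod_filter, ← Finset.prod_mul_distrib]
      refine Finset.prod_congr rfl fun j _ => ?_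
      simp only [hy]
      split_ifs <;> simp
    -- The vertex `b` of the edge has a nonzero value, so at most `k - 1` factors are equal to `t`.
    have h2 : ((E e).filter fun j => x j = 0).card ≤ k - 1 := by
      have : ((E e).filter fun j => x j = 0).card < (E e).card :=
        Finset.card_lt_card (Finset.filter_ssubset.mpr ⟨b, hbe, hb⟩)
      rw [hE e] at this
      omega
    rw [h1]
    exact mul_le_mul_of_nonneg_right (pow_le_pow_of_le_one ht ht1 h2) hPpos.le
  have hprod0 : ∏ j ∈ E e, x j = 0 := Finset.prod_eq_zero hae ha
  have hform : ∀ t, 0 ≤ t → t ≤ 1 →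
      edgesForm E α k x + (1 - α) * k * (t ^ (k - 1) * P) ≤ edgesForm E α k (y t) := by
    intro t ht ht1
    have hxy : ∀ j, x j ≤ y t j := fun j => by
      simp only [hy]
      split_ifs with h
      · rw [h]; exact ht
      · exact le_rfl
    unfold edgesForm
    rw [← Finset.add_sum_erase _ _ (Finset.mem_univ e),
      ← Finset.add_sum_erase _ (fun e => edgeForm α k (y t) (E e)) (Finset.mem_univ e),
      add_right_comm]
    refine add_le_add ?_ (Finset.sum_le_sum fun f _ =>
      edgeForm_mono hα0 hα1.le (fun j _ => hx j) fun j _ => hxy j)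
    unfold edgeForm
    rw [hprod0, mul_zero, add_zero]
    refine add_le_add (mul_le_mul_of_nonneg_left (Finset.sum_le_sum fun j _ =>
      pow_le_pow_left₀ (hx j) (hxy j) k) hα0) (mul_le_mul_of_nonneg_left (hprod t ht ht1) ?_)
    exact mul_nonneg (by linarith) (Nat.cast_nonneg k)
  have hnorm : ∀ t, 0 ≤ t → ∑ j, y t j ^ k =
      ∑ j, x j ^ k + (Finset.univ.filter fun j => x j = 0).card * t ^ k := by
    intro t ht
    rw [← nsmul_eq_mul, ← Finset.sum_const, Finset.sum_filter, ← Finset.sum_add_distrib]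
    refine Finset.sum_congr rfl fun j _ => ?_
    simp only [hy]
    split_ifs with h
    · rw [h, zero_pow hkpos.ne', zero_add]
    · rw [add_zero]
  set m : ℝ := ((Finset.univ.filter fun j => x j = 0).card : ℝ) with hm
  have hineq : ∀ t, 0 < t → t ≤ 1 → (1 - α) * k * P ≤ c * m * t := by
    intro t ht ht1
    have h1 := hc (y t) fun j => by
      simp only [hy]
      split_ifs
      · exact ht.le
      · exact hx j
    rw [hnorm t ht.le] at h1
    have h2 := hform t ht.le ht1
    rw [hxc] at h2
    have h3 : t ^ k = t ^ (k - 1) * t := by rw [← pow_succ, Nat.sub_add_cancel hkpos]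
    rw [h3] at h1
    have h4 : t ^ (k - 1) * ((1 - α) * k * P) ≤ t ^ (k - 1) * (c * m * t) := by linarith
    exact le_of_mul_le_mul_left h4 (pow_pos ht _)
  have hlim : Filter.Tendsto (fun t : ℝ => c * m * t) (nhdsWithin 0 (Set.Ioi 0))
      (nhds (c * m * 0)) := by
    refine Filter.Tendsto.mono_left (Continuous.tendsto ?_ 0) nhdsWithin_le_nhds
    fun_prop
  have hle : (1 - α) * k * P ≤ c * m * 0 := by
    refine ge_of_tendsto hlim ?_
    filter_upwards [Ioc_mem_nhdsGT one_pos] with t ht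
    exact hineq t ht.1 ht.2
  have hpos : 0 < (1 - α) * k * P :=
    mul_pos (mul_pos (by linarith) (Nat.cast_pos.mpr hkpos)) hPpos
  linarith

end Form

/-! ### The spectral radius as the maximum of the form -/

open Finset in
-- The tuples with image `s` are the `n!` bijections onto `s`, all with the same product. This
-- cancels the factor `1 / (k - 1)!` of the adjacency tensor.
theorem sum_prod_filter_image_eq {ι R : Type*} [Fintype ι] [DecidableEq ι] [CommSemiring R]
    {n : ℕ} {s : Finset ι} (hs : s.card = n) (X : ι → R) :
    ∑ j : Fin n → ι, (if univ.image j = s then ∏ t, X (j t) else 0) =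
      (n.factorial : R) * ∏ i ∈ s, X i := by
  have hinj : ∀ j : Fin n → ι, univ.image j = s → Function.Injective j := fun j hj => by
    have h : (univ.image j).card = (univ : Finset (Fin n)).card := by
      rw [hj, hs, card_univ, Fintype.card_fin]
    intro a b hab
    exact card_image_iff.mp h (mem_coe.mpr (mem_univ a)) (mem_coe.mpr (mem_univ b)) hab
  have hval : ∀ j : Fin n → ι, univ.image j = s → ∏ t, X (j t) = ∏ i ∈ s, X i := fun j hj => by
    rw [← hj, prod_image fun a _ b _ h => hinj j hj h]
  have hcard : (univ.filter fun j : Fin n → ι => univ.image j = s).card = n.factorial := by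
    have e : Fin n ≃ s := (Fintype.equivFinOfCardEq (by simpa using hs)).symm
    have h := Fintype.card_equiv e
    rw [Fintype.card_fin] at h
    rw [← h, ← card_univ]
    symm
    refine card_bij (fun σ _ t => (σ t : ι)) ?_ ?_ ?_
    · intro σ _
      simp only [mem_filter, mem_univ, true_and]
      ext a
      simp only [mem_image, mem_univ, true_and]
      exact ⟨fun ⟨t, ht⟩ => ht ▸ (σ t).2, fun ha => ⟨σ.symm ⟨a, ha⟩, by simp⟩⟩
    · intro σ _ τ _ h
      ext t
      exact congrFun h t
    · intro j hj
      simp only [mem_filter, mem_univ, true_and] at hj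
      have hmem : ∀ t, j t ∈ s := fun t => hj ▸ mem_image_of_mem j (mem_univ t)
      refine ⟨Equiv.ofBijective (fun t => ⟨j t, hmem t⟩) ⟨?_, ?_⟩, mem_univ _, rfl⟩
      · intro a b hab
        exact hinj j hj (congrArg Subtype.val hab)
      · rintro ⟨a, ha⟩
        rw [← hj] at ha
        obtain ⟨t, -, rfl⟩ := mem_image.mp ha
        exact ⟨t, rfl⟩
  rw [← sum_filter, sum_congr rfl fun j hj => hval j (mem_filter.mp hj).2, sum_const, hcard,
    nsmul_eq_mul]

/-- `H` is the hypergraph with vertices `φ i` and with edges `φ '' E e`, without repetitions. -/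
structure Represents {V ι ε : Type*} (H : Hypergraph V) (φ : ι → V) (E : ε → Finset ι) :
    Prop where
  inj : Function.Injective φ
  range_eq : Set.range φ = H.vertexSet
  edge_inj : Function.Injective E
  edges : Set.range (fun e => φ '' (E e : Set ι)) = H.edgeSet

namespace Represents

variable {V ι ε : Type*} {H : Hypergraph V} {φ : ι → V} {E : ε → Finset ι}

theorem mem_edgeSet (h : Represents H φ E) (s : Finset ι) :
    φ '' (s : Set ι) ∈ H.edgeSet ↔ ∃ e, E e = s := by
  rw [← h.edges]
  constructor
  · rintro ⟨e, he⟩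
    exact ⟨e, Finset.coe_injective (h.inj.image_injective he)⟩
  · rintro ⟨e, rfl⟩
    exact ⟨e, rfl⟩

/-- The vertices of `H`, as labelled by `φ`. -/
noncomputable def equiv (h : Represents H φ E) : ι ≃ H.vertexSet :=
  (Equiv.ofInjective φ h.inj).trans (Equiv.setCongr h.range_eq)

theorem coe_equiv (h : Represents H φ E) (i : ι) : (h.equiv i : V) = φ i := rfl

variable [Fintype ε] [DecidableEq ι]

theorem degree_eq (h : Represents H φ E) (i : ι) :
    H.degree (φ i) = (Finset.univ.filter fun e => i ∈ E e).card := by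
  have h1 : {f ∈ H.edgeSet | φ i ∈ f} =
      (fun e => φ '' (E e : Set ι)) '' (Finset.univ.filter fun e => i ∈ E e : Finset ε) := by
    ext f
    rw [← h.edges]
    constructor
    · rintro ⟨⟨e, rfl⟩, hi⟩
      refine ⟨e, ?_, rfl⟩
      simpa using (h.inj.mem_set_image).mp hi
    · rintro ⟨e, he, rfl⟩
      refine ⟨⟨e, rfl⟩, (h.inj.mem_set_image).mpr ?_⟩
      simpa using he
  have h2 : Function.Injective fun e => φ '' (E e : Set ι) := fun a b hab =>
    h.edge_inj (Finset.coe_injective (h.inj.image_injective hab))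
  rw [Hypergraph.degree, h1, Set.ncard_image_of_injective _ h2, Set.ncard_coe_finset]

variable [Fintype ι]

theorem apply_eq (h : Represents H φ E) {k : ℕ}
    (hE : ∀ e, (E e).card = k) (α : ℝ) (x : H.vertexSet → ℂ) (i : ι) :
    (H.alphaTensor k α).apply x (h.equiv i) = ∑ e, if i ∈ E e then
      (α : ℂ) * x (h.equiv i) ^ (k - 1) + (1 - α) * ∏ j ∈ (E e).erase i, x (h.equiv j) else 0 := by
  classical
  have : Fintype H.vertexSet := Fintype.ofEquiv ι h.equiv
  set X : ι → ℂ := fun j => x (h.equiv j) with hX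
  have hmem : ∀ j : Fin (k - 1) → ι,
      (insert (h.equiv i : V) (Set.range fun t => (h.equiv (j t) : V)) ∈ H.edgeSet) ↔
        ∃ e, E e = insert i (Finset.univ.image j) := by
    intro j
    rw [← h.mem_edgeSet]
    have : φ '' ((insert i (Finset.univ.image j) : Finset ι) : Set ι) =
        insert (h.equiv i : V) (Set.range fun t => (h.equiv (j t) : V)) := by
      simp only [Finset.coe_insert, Finset.coe_image, Finset.coe_univ, Set.image_univ,
        Set.image_insert_eq, h.coe_equiv]
      rw [← Set.range_comp]
      rfl
    rw [this]
  have hadj : ∀ j : Fin (k - 1) → ι,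
      ((H.adjacencyTensor k (h.equiv i) fun t => h.equiv (j t) : ℝ) : ℂ) =
        ∑ e, if insert i (Finset.univ.image j) = E e then 1 / ((k - 1).factorial : ℂ) else 0 := by
    intro j
    simp only [Hypergraph.adjacencyTensor, hmem j]
    split_ifs with hj
    · obtain ⟨e, he⟩ := hj
      rw [Finset.sum_eq_single e]
      · rw [if_pos he.symm]; push_cast; rfl
      · intro f _ hf
        rw [if_neg fun hf' => hf (h.edge_inj (hf'.symm.trans he.symm))]
      · simp
    · rw [Finset.sum_eq_zero fun e _ => if_neg fun he => hj ⟨e, he.symm⟩]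
      simp
  have hsum : ∀ e, ∑ j : Fin (k - 1) → ι,
      (if insert i (Finset.univ.image j) = E e then 1 / ((k - 1).factorial : ℂ) else 0) *
        ∏ t, X (j t) = if i ∈ E e then ∏ l ∈ (E e).erase i, X l else 0 := by
    intro e
    split_ifs with hi
    · have hcard : ((E e).erase i).card = k - 1 := by rw [Finset.card_erase_of_mem hi, hE]
      -- The image of `j` has at most `k - 1` elements and must cover the `k - 1` vertices of the
      -- edge other than `i`, so it cannot contain `i`.
      have hiff : ∀ j : Fin (k - 1) → ι, insert i (Finset.univ.image j) = E e ↔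
          Finset.univ.image j = (E e).erase i := by
        intro j
        constructor
        · intro hj
          symm
          refine Finset.eq_of_subset_of_card_le ?_ ?_
          · rw [← hj]
            exact Finset.erase_insert_subset _ _
          · rw [hcard]
            exact Finset.card_image_le.trans (by simp)
        · intro hj
          rw [hj, Finset.insert_erase hi]
      have hf : ((k - 1).factorial : ℂ) ≠ 0 := Nat.cast_ne_zero.mpr (Nat.factorial_ne_zero _)
      calc _ = ∑ j : Fin (k - 1) → ι, 1 / ((k - 1).factorial : ℂ) *
            (if Finset.univ.image j = (E e).erase i then ∏ t, X (j t) else 0) := by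
            refine Finset.sum_congr rfl fun j _ => ?_
            simp only [hiff j]
            split_ifs <;> simp
        _ = _ := by
            rw [← Finset.mul_sum, sum_prod_filter_image_eq hcard]
            field_simp
    · refine Finset.sum_eq_zero fun j _ => ?_
      rw [if_neg, zero_mul]
      intro hj
      exact hi (hj ▸ Finset.mem_insert_self _ _)
  have hdeg : ∑ j : Fin (k - 1) → ι,
      ((H.degreeTensor k (h.equiv i) fun t => h.equiv (j t) : ℝ) : ℂ) * ∏ t, X (j t) =
        ∑ e, if i ∈ E e then X i ^ (k - 1) else 0 := by
    rw [Finset.sum_eq_single fun _ => i]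
    · simp only [Hypergraph.degreeTensor, h.coe_equiv, h.degree_eq]
      rw [← Finset.sum_filter]
      simp
    · intro j _ hj
      have : ¬ ∀ t, h.equiv (j t) = h.equiv i := fun hall =>
        hj (funext fun t => h.equiv.injective (hall t))
      rw [Hypergraph.degreeTensor, if_neg this, Complex.ofReal_zero, zero_mul]
    · simp
  rw [RealTensor.apply, finsum_eq_sum_of_fintype,
    ← (Equiv.arrowCongr (Equiv.refl (Fin (k - 1))) h.equiv).sum_comp]
  change ∑ j : Fin (k - 1) → ι,
    ((α * H.degreeTensor k (h.equiv i) (fun t => h.equiv (j t)) +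
      (1 - α) * H.adjacencyTensor k (h.equiv i) (fun t => h.equiv (j t)) : ℝ) : ℂ) *
        ∏ t, x (h.equiv (j t)) = _
  have h1 : ∀ j : Fin (k - 1) → ι,
      ((α * H.degreeTensor k (h.equiv i) (fun t => h.equiv (j t)) +
        (1 - α) * H.adjacencyTensor k (h.equiv i) (fun t => h.equiv (j t)) : ℝ) : ℂ) *
          ∏ t, x (h.equiv (j t)) =
      α * (((H.degreeTensor k (h.equiv i) fun t => h.equiv (j t) : ℝ) : ℂ) * ∏ t, X (j t)) +
      (1 - α) * ∑ e, (if insert i (Finset.univ.image j) = E e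
        then 1 / ((k - 1).factorial : ℂ) else 0) * ∏ t, X (j t) := by
    intro j
    rw [← Finset.sum_mul, ← hadj j]
    push_cast
    ring
  rw [Finset.sum_congr rfl fun j _ => h1 j, Finset.sum_add_distrib, ← Finset.mul_sum,
    ← Finset.mul_sum, hdeg, Finset.sum_comm, Finset.sum_congr rfl fun e _ => hsum e,
    Finset.mul_sum, Finset.mul_sum, ← Finset.sum_add_distrib]
  refine Finset.sum_congr rfl fun e _ => ?_
  split_ifs <;> simp [hX]

/-- Upper bound: take moduli in the eigenvalue equation, multiply by the coordinate and sum; each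
edge is then counted once per vertex, which produces the form at the moduli. Lower bound: the
maximizer is itself an eigenvector for `c`. -/
theorem alphaSpectralRadius_eq (h : Represents H φ E) {k : ℕ} (hk : 2 ≤ k)
    (hE : ∀ e, (E e).card = k) {α : ℝ} (hα0 : 0 ≤ α) (hα1 : α ≤ 1) {c : ℝ} (hc0 : 0 ≤ c)
    (hc : IsFormBound E α k c) {x : ι → ℝ} (hx : ∀ i, 0 ≤ x i) (hx0 : x ≠ 0)
    (hxc : edgesForm E α k x = c * ∑ i, x i ^ k) :
    H.alphaSpectralRadius k α = ENNReal.ofReal c := by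
  have hkk : k - 1 + 1 = k := Nat.sub_add_cancel (by omega)
  apply le_antisymm
  · refine iSup₂_le fun μ hμ => ?_
    obtain ⟨z, hz0, hz⟩ := hμ
    set y : ι → ℝ := fun i => ‖z (h.equiv i)‖ with hy
    have hy0 : ∀ i, 0 ≤ y i := fun i => norm_nonneg _
    have hyne : y ≠ 0 := by
      intro hy'
      refine hz0 (funext fun w => ?_)
      have := congrFun hy' (h.equiv.symm w)
      simpa [hy] using this
    have hle : ∀ i, ‖μ‖ * y i ^ k ≤
        ∑ e, if i ∈ E e then α * y i ^ k + (1 - α) * ∏ j ∈ E e, y j else 0 := by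
      intro i
      have h1 := congrArg norm (hz (h.equiv i))
      rw [h.apply_eq hE, norm_mul, norm_pow] at h1
      have h2 : ‖μ‖ * y i ^ (k - 1) ≤ ∑ e, if i ∈ E e then
          α * y i ^ (k - 1) + (1 - α) * ∏ j ∈ (E e).erase i, y j else 0 := by
        rw [← h1]
        refine (norm_sum_le _ _).trans (Finset.sum_le_sum fun e _ => ?_)
        split_ifs
        · refine (norm_add_le _ _).trans (le_of_eq ?_)
          have h3 : ‖(1 - α : ℂ)‖ = 1 - α := by
            have : (1 - α : ℂ) = ((1 - α : ℝ) : ℂ) := by push_cast; rfl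
            rw [this, Complex.norm_real, Real.norm_of_nonneg (by linarith)]
          rw [norm_mul, norm_mul, norm_pow, norm_prod, h3, Complex.norm_real,
            Real.norm_of_nonneg hα0]
        · simp
      have h4 := mul_le_mul_of_nonneg_right h2 (hy0 i)
      rw [mul_assoc, ← pow_succ, hkk, Finset.sum_mul] at h4
      refine h4.trans (le_of_eq (Finset.sum_congr rfl fun e _ => ?_))
      split_ifs with hi
      · rw [← Finset.prod_erase_mul _ y hi, ← hkk, Nat.add_sub_cancel, pow_succ]
        ring
      · rw [zero_mul]
    have hsum : ‖μ‖ * ∑ i, y i ^ k ≤ edgesForm E α k y := by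
      rw [Finset.mul_sum]
      refine (Finset.sum_le_sum fun i _ => hle i).trans (le_of_eq ?_)
      rw [Finset.sum_comm]
      refine Finset.sum_congr rfl fun e _ => ?_
      rw [← Finset.sum_filter, Finset.filter_mem_eq_inter, Finset.univ_inter,
        Finset.sum_add_distrib, Finset.sum_const, hE, nsmul_eq_mul, ← Finset.mul_sum, edgeForm]
      ring
    have hμc : ‖μ‖ ≤ c :=
      le_of_mul_le_mul_right (hsum.trans (hc y hy0)) (sum_pow_pos hy0 hyne)
    rw [← ofReal_norm]
    exact ENNReal.ofReal_le_ofReal hμc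
  · have heig : (H.alphaTensor k α).IsEigenvalue (c : ℂ) := by
      refine ⟨fun w => (x (h.equiv.symm w) : ℂ), ?_, fun w => ?_⟩
      · intro h0
        refine hx0 (funext fun i => ?_)
        have := congrFun h0 (h.equiv i)
        simpa using this
      · obtain ⟨i, rfl⟩ := h.equiv.surjective w
        rw [h.apply_eq hE]
        simp only [Equiv.symm_apply_apply]
        have := hc.eigen_eq hk hα1 hx hxc i
        have h2 := congrArg (fun r : ℝ => (r : ℂ)) this
        push_cast at h2
        rw [h2]
        refine Finset.sum_congr rfl fun e _ => ?_
        split_ifs <;> push_cast <;> rfl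
    have h1 : ENNReal.ofReal c = ‖(c : ℂ)‖ₑ := by
      rw [← ofReal_norm, Complex.norm_real, Real.norm_of_nonneg hc0]
    rw [h1]
    exact le_iSup₂ (f := fun (μ : ℂ) (_ : μ ∈ {μ : ℂ | (H.alphaTensor k α).IsEigenvalue μ}) => ‖μ‖ₑ)
      (c : ℂ) heig

end Represents

/-! ### Attaching a loose path: edges, values and eigenvalue equations -/

open Hypergraph

/-- The value `α (s ^ k + ∑ f ^ k) + (1 - α) k s ∏ f` of `edgeForm` at an edge that consists of one
vertex of value `s` and of further vertices with the values `f`. -/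
noncomputable def starForm {κ : Type*} [Fintype κ] (α : ℝ) (k : ℕ) (s : ℝ) (f : κ → ℝ) : ℝ :=
  α * (s ^ k + ∑ o, f o ^ k) + (1 - α) * k * (s * ∏ o, f o)

/-- The value at the first vertex of the `i`-th edge of a path that starts at value `s` and has
the values `A` at its other vertices. -/
def armStart {κ : Type*} (s : ℝ) (A : ℕ → Option κ → ℝ) (i : ℕ) : ℝ :=
  if i = 0 then s else A (i - 1) none

section Attach

variable {ι ε : Type*} [DecidableEq ι]

/-- The edges of a hypergraph with edges `E` after attaching at `u` a loose path of `p` edges. -/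
def attachEdges (E : ε → Finset ι) (k : ℕ) (u : ι) (p : ℕ) :
    ε ⊕ Fin p → Finset (ι ⊕ PathVertex k p)
  | .inl e => (E e).map Function.Embedding.inl
  | .inr i => insert (pathStart k u i) (Finset.univ.image fun c => Sum.inr (i, c))

variable {E : ε → Finset ι} {k : ℕ} {u : ι} {p : ℕ}

omit [DecidableEq ι] in
theorem pathStart_ne_inr (i j : Fin p) (c : Fin (k - 2)) :
    pathStart k u i ≠ Sum.inr (j, some c) := by
  unfold pathStart
  split_ifs <;> simp

omit [DecidableEq ι] in
theorem pathStart_ne_inr_self (i : Fin p) (o : Option (Fin (k - 2))) :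
    pathStart k u i ≠ Sum.inr (i, o) := by
  unfold pathStart
  split_ifs with h
  · simp
  · intro h'
    have h1 := (Prod.mk.injEq .. ▸ (Sum.inr_injective h')).1
    have := congrArg Fin.val h1
    simp only at this
    omega

omit [DecidableEq ι] in
theorem pathStart_eq_inr_none {i j : Fin p} :
    pathStart k u i = Sum.inr (j, none) ↔ (i : ℕ) = j + 1 := by
  unfold pathStart
  split_ifs with h
  · simp [h]
  · simp only [Sum.inr.injEq, Prod.mk.injEq, and_true, Fin.ext_iff]
    omega

omit [DecidableEq ι] in
theorem pathStart_eq_inl {i : Fin p} {w : ι} :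
    pathStart k u i = Sum.inl w ↔ (i : ℕ) = 0 ∧ u = w := by
  unfold pathStart
  split_ifs with h <;> simp [h]

omit [DecidableEq ι] in
theorem inr_injective_right (i : Fin p) :
    Function.Injective fun c => (Sum.inr (i, c) : ι ⊕ PathVertex k p) := fun a b hab => by
  simpa using hab

theorem card_attachEdges (hk : 2 ≤ k) (hE : ∀ e, (E e).card = k) (e : ε ⊕ Fin p) :
    (attachEdges E k u p e).card = k := by
  rcases e with e | i
  · simp [attachEdges, hE]
  · rw [attachEdges, Finset.card_insert_of_notMem, Finset.card_image_of_injective _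
      (inr_injective_right i), Finset.card_univ, Fintype.card_option, Fintype.card_fin]
    · omega
    · simp only [Finset.mem_image, Finset.mem_univ, true_and, not_exists]
      exact fun c hc => pathStart_ne_inr_self i c hc.symm

/-- For `k ≥ 3` every path edge has an inner vertex `(i, some c)`, which lies on no other edge. -/
theorem attachEdges_injective (hk : 3 ≤ k) (hE : Function.Injective E) :
    Function.Injective (attachEdges E k u p) := by
  have hmem : ∀ (i : Fin p) (c : Fin (k - 2)) (e : ε ⊕ Fin p),
      Sum.inr (i, some c) ∈ attachEdges E k u p e → e = Sum.inr i := by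
    rintro i c (e | j) h
    · simp [attachEdges] at h
    · simp only [attachEdges, Finset.mem_insert, Finset.mem_image, Finset.mem_univ, true_and] at h
      rcases h with h | ⟨c', h⟩
      · exact absurd h.symm (pathStart_ne_inr j i c)
      · simp only [Sum.inr.injEq, Prod.mk.injEq] at h
        rw [h.1]
  have hself : ∀ i : Fin p, Sum.inr (i, some ⟨0, by omega⟩) ∈ attachEdges E k u p (Sum.inr i) :=
    fun i => Finset.mem_insert_of_mem (Finset.mem_image_of_mem _ (Finset.mem_univ _))
  rintro (e | i) (f | j) h
  · exact congrArg _ (hE (Finset.map_injective _ h))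
  · exact hmem j _ _ (h ▸ hself j)
  · exact (hmem i _ _ (h ▸ hself i)).symm
  · exact (hmem i _ _ (h ▸ hself i)).symm

theorem Represents.attachPath {V : Type*} {H : Hypergraph V} {φ : ι → V}
    (h : Represents H φ E) (hk : 3 ≤ k) (u : ι) (p : ℕ) :
    Represents (H.attachPath k (φ u) p) (Sum.map φ id) (attachEdges E k u p) where
  inj := h.inj.sumMap Function.injective_id
  range_eq := by
    simp only [Hypergraph.attachPath, ← h.range_eq]
    ext x
    rcases x with x | x <;> simp
  edge_inj := attachEdges_injective hk h.edge_inj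
  edges := by
    have hstart : ∀ i : Fin p, Sum.map φ id (pathStart k u i) = pathStart k (φ u) i := fun i => by
      unfold pathStart
      split_ifs <;> rfl
    have h1 : ∀ e, Sum.map φ id '' (attachEdges E k u p (Sum.inl e) : Set (ι ⊕ PathVertex k p)) =
        Set.image Sum.inl (φ '' (E e : Set ι)) := fun e => by
      simp only [attachEdges, Finset.coe_map, Function.Embedding.inl_apply, Set.image_image,
        Sum.map_inl]
    have h2 : ∀ i : Fin p,
        Sum.map φ id '' (attachEdges E k u p (Sum.inr i) : Set (ι ⊕ PathVertex k p)) =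
          pathEdge k (φ u) i := fun i => by
      simp only [attachEdges, Finset.coe_insert, Finset.coe_image, Finset.coe_univ,
        Set.image_univ, Set.image_insert_eq, hstart, pathEdge, ← Set.range_comp]
      rfl
    simp only [Hypergraph.attachPath, ← h.edges]
    ext s
    simp only [Set.mem_range, Set.mem_union, Set.mem_image, Sum.exists, h1, h2]
    simp

omit [DecidableEq ι] in
theorem armStart_eq {x : ι ⊕ PathVertex k p → ℝ} {g : ι → ℝ} {A : ℕ → Option (Fin (k - 2)) → ℝ}
    (hg : ∀ i, x (Sum.inl i) = g i) (hA : ∀ (i : Fin p) o, x (Sum.inr (i, o)) = A i o)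
    (i : Fin p) : x (pathStart k u i) = armStart (g u) A i := by
  unfold pathStart armStart
  split_ifs
  · exact hg u
  · exact hA _ _

section Values

variable {x : ι ⊕ PathVertex k p → ℝ} {g : ι → ℝ} {A : ℕ → Option (Fin (k - 2)) → ℝ}

theorem prod_attachEdges_inr (hg : ∀ i, x (Sum.inl i) = g i)
    (hA : ∀ (i : Fin p) o, x (Sum.inr (i, o)) = A i o) (i : Fin p) :
    ∏ j ∈ attachEdges E k u p (Sum.inr i), x j = armStart (g u) A i * ∏ o, A i o := by
  rw [attachEdges, Finset.prod_insert, Finset.prod_image fun a _ b _ h => inr_injective_right i h,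
    armStart_eq hg hA]
  · simp only [hA]
  · simp only [Finset.mem_image, Finset.mem_univ, true_and, not_exists]
    exact fun c hc => pathStart_ne_inr_self i c hc.symm

theorem edgeForm_attachEdges_inr {α : ℝ} (hg : ∀ i, x (Sum.inl i) = g i)
    (hA : ∀ (i : Fin p) o, x (Sum.inr (i, o)) = A i o) (i : Fin p) :
    edgeForm α k x (attachEdges E k u p (Sum.inr i)) =
      starForm α k (armStart (g u) A i) (A i) := by
  rw [edgeForm, starForm, prod_attachEdges_inr hg hA]
  congr 2
  rw [attachEdges, Finset.sum_insert, Finset.sum_image fun a _ b _ h => inr_injective_right i h,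
    armStart_eq hg hA]
  · simp only [hA]
  · simp only [Finset.mem_image, Finset.mem_univ, true_and, not_exists]
    exact fun c hc => pathStart_ne_inr_self i c hc.symm

theorem edgesForm_attachEdges [Fintype ε] {α : ℝ} (hg : ∀ i, x (Sum.inl i) = g i)
    (hA : ∀ (i : Fin p) o, x (Sum.inr (i, o)) = A i o) :
    edgesForm (attachEdges E k u p) α k x = edgesForm E α k g +
      ∑ i ∈ Finset.range p, starForm α k (armStart (g u) A i) (A i) := by
  rw [edgesForm, Fintype.sum_sum_type, edgesForm,
    ← Fin.sum_univ_eq_sum_range fun i => starForm α k (armStart (g u) A i) (A i)]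
  congr 1
  · refine Finset.sum_congr rfl fun e _ => ?_
    simp [edgeForm, attachEdges, hg]
  · exact Finset.sum_congr rfl fun i _ => edgeForm_attachEdges_inr hg hA i

omit [DecidableEq ι] in
theorem sum_pow_attachEdges [Fintype ι] (hg : ∀ i, x (Sum.inl i) = g i)
    (hA : ∀ (i : Fin p) o, x (Sum.inr (i, o)) = A i o) :
    ∑ i, x i ^ k = ∑ i, g i ^ k + ∑ i ∈ Finset.range p, ∑ o, A i o ^ k := by
  rw [Fintype.sum_sum_type, ← Fin.sum_univ_eq_sum_range fun i => ∑ o, A i o ^ k,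
    Fintype.sum_prod_type]
  simp only [hg, hA]

end Values

/-- The right-hand side of the eigenvalue equation at `i`, multiplied by the coordinate. -/
noncomputable def edgesAt [Fintype ε] (E : ε → Finset ι) (α : ℝ) (k : ℕ) (x : ι → ℝ) (i : ι) : ℝ :=
  ∑ e, if i ∈ E e then α * x i ^ k + (1 - α) * ∏ j ∈ E e, x j else 0

section Equations

variable [Fintype ε] {α : ℝ} {x : ι ⊕ PathVertex k p → ℝ} {g : ι → ℝ}
  {A : ℕ → Option (Fin (k - 2)) → ℝ}

theorem edgesAt_attachEdges_inl (hg : ∀ i, x (Sum.inl i) = g i)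
    (hA : ∀ (i : Fin p) o, x (Sum.inr (i, o)) = A i o) (w : ι) :
    edgesAt (attachEdges E k u p) α k x (Sum.inl w) = edgesAt E α k g w +
      if w = u ∧ 0 < p then α * g u ^ k + (1 - α) * (g u * ∏ o, A 0 o) else 0 := by
  rw [edgesAt, Fintype.sum_sum_type, edgesAt]
  congr 1
  · refine Finset.sum_congr rfl fun e _ => ?_
    simp [attachEdges, hg]
  · have hmem : ∀ i : Fin p,
        Sum.inl w ∈ attachEdges E k u p (Sum.inr i) ↔ (i : ℕ) = 0 ∧ u = w := fun i => by
      simp only [attachEdges, Finset.mem_insert, Finset.mem_image, Finset.mem_univ, true_and,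
        reduceCtorEq, exists_false, or_false]
      rw [eq_comm, pathStart_eq_inl]
    simp only [hmem]
    split_ifs with h
    · obtain ⟨rfl, hp⟩ := h
      rw [Finset.sum_eq_single ⟨0, hp⟩]
      · rw [if_pos ⟨rfl, rfl⟩, prod_attachEdges_inr hg hA, hg]
        rfl
      · intro i _ hi
        rw [if_neg fun h => hi (Fin.ext h.1)]
      · simp
    · refine Finset.sum_eq_zero fun i _ => if_neg fun hi => h ⟨hi.2.symm, ?_⟩
      exact i.pos

theorem edgesAt_attachEdges_inr (hg : ∀ i, x (Sum.inl i) = g i)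
    (hA : ∀ (i : Fin p) o, x (Sum.inr (i, o)) = A i o) (i : ℕ) (hi : i < p) :
    edgesAt (attachEdges E k u p) α k x (Sum.inr (⟨i, hi⟩, none)) =
      (α * A i none ^ k + (1 - α) * (armStart (g u) A i * ∏ o, A i o)) +
      if i + 1 < p then
        α * A i none ^ k + (1 - α) * (A i none * ∏ o, A (i + 1) o) else 0 := by
  have hmem : ∀ j : Fin p, Sum.inr (⟨i, hi⟩, none) ∈ attachEdges E k u p (Sum.inr j) ↔
      (j : ℕ) = i ∨ (j : ℕ) = i + 1 := fun j => by
    simp only [attachEdges, Finset.mem_insert, Finset.mem_image, Finset.mem_univ, true_and]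
    rw [eq_comm, pathStart_eq_inr_none, or_comm]
    simp [Fin.ext_iff]
  have hsplit : ∀ j : Fin p, (if Sum.inr (⟨i, hi⟩, none) ∈ attachEdges E k u p (Sum.inr j) then
      α * x (Sum.inr (⟨i, hi⟩, none)) ^ k + (1 - α) * ∏ l ∈ attachEdges E k u p (Sum.inr j), x l
        else 0) =
      (if (j : ℕ) = i then
        α * A i none ^ k + (1 - α) * (armStart (g u) A i * ∏ o, A i o) else 0) +
      (if (j : ℕ) = i + 1 then
        α * A i none ^ k + (1 - α) * (A i none * ∏ o, A (i + 1) o) else 0) := fun j => by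
    simp only [hmem j, prod_attachEdges_inr hg hA, hA]
    by_cases h1 : (j : ℕ) = i
    · have h2 : (j : ℕ) ≠ i + 1 := by omega
      simp [h1]
    · by_cases h2 : (j : ℕ) = i + 1
      · simp [h2, armStart]
      · simp [h1, h2]
  have hsingle : ∀ (m : ℕ) (r : ℝ), (∑ j : Fin p, if (j : ℕ) = m then r else 0) =
      if m < p then r else 0 := fun m r => by
    rw [Fin.sum_univ_eq_sum_range fun j => if j = m then r else 0, Finset.sum_ite_eq']
    simp
  rw [edgesAt, Fintype.sum_sum_type, Finset.sum_eq_zero fun e _ => if_neg (by simp [attachEdges]),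
    zero_add, Finset.sum_congr rfl fun j _ => hsplit j, Finset.sum_add_distrib, hsingle, hsingle,
    if_pos hi]

end Equations

theorem EdgesConnected.attachEdges (hE : EdgesConnected E) (u : ι) (p : ℕ) :
    EdgesConnected (attachEdges E k u p) := by
  intro S hS hclosed
  have hbase : ∀ w, Sum.inl w ∈ S → ∀ i, Sum.inl i ∈ S := by
    intro w hw
    refine hE {i | Sum.inl i ∈ S} ⟨w, hw⟩ fun e i hi hiS j hj => ?_
    exact hclosed (Sum.inl e) (Sum.inl i) (by simpa [_root_.attachEdges] using hi) hiS (Sum.inl j)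
      (by simpa [_root_.attachEdges] using hj)
  have hstart : ∀ i : Fin p, pathStart k u i ∈ _root_.attachEdges E k u p (Sum.inr i) := fun i =>
    Finset.mem_insert_self _ _
  have hinr : ∀ (i : Fin p) o, Sum.inr (i, o) ∈ _root_.attachEdges E k u p (Sum.inr i) :=
    fun i o => Finset.mem_insert_of_mem (Finset.mem_image_of_mem _ (Finset.mem_univ _))
  have hdown : ∀ (n : ℕ) (i : Fin p), (i : ℕ) = n → ∀ o, Sum.inr (i, o) ∈ S → Sum.inl u ∈ S := by
    intro n
    induction n with
    | zero =>
      intro i hi o ho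
      have h1 := hclosed (Sum.inr i) _ (hinr i o) ho _ (hstart i)
      rwa [pathStart_eq_inl.mpr ⟨hi, rfl⟩] at h1
    | succ n ih =>
      intro i hi o ho
      have h1 := hclosed (Sum.inr i) _ (hinr i o) ho _ (hstart i)
      have hn : n < p := by omega
      rw [pathStart_eq_inr_none (j := ⟨n, hn⟩) |>.mpr hi] at h1
      exact ih ⟨n, hn⟩ rfl none h1
  have hu : Sum.inl u ∈ S := by
    obtain ⟨w | ⟨i, o⟩, hw⟩ := hS
    · exact hbase w hw u
    · exact hdown i i rfl o hw
  have hup : ∀ (n : ℕ) (i : Fin p), (i : ℕ) = n → ∀ o, Sum.inr (i, o) ∈ S := by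
    intro n
    induction n with
    | zero =>
      intro i hi o
      refine hclosed (Sum.inr i) _ (hstart i) ?_ _ (hinr i o)
      rwa [pathStart_eq_inl.mpr ⟨hi, rfl⟩]
    | succ n ih =>
      intro i hi o
      have hn : n < p := by omega
      refine hclosed (Sum.inr i) _ (hstart i) ?_ _ (hinr i o)
      rw [pathStart_eq_inr_none (j := ⟨n, hn⟩) |>.mpr hi]
      exact ih ⟨n, hn⟩ rfl none
  rintro (w | ⟨i, o⟩)
  · exact hbase u hu w
  · exact hup i i rfl o

end Attach

/-! ### Polarization: replacing two arms by their maximum and minimum -/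

section Polarization

/-- For `s ≤ t` the difference of the two sides is `s (P + Q - F - G) + (t - s) (P - G)`. This is
the induction step for the supermodularity of products. -/
theorem mul_add_mul_le_max_min {s t F G P Q : ℝ} (hs : 0 ≤ s) (ht : 0 ≤ t) (hFP : F ≤ P)
    (hGP : G ≤ P) (h : F + G ≤ P + Q) : s * F + t * G ≤ max s t * P + min s t * Q := by
  rcases le_total s t with hst | hst
  · rw [max_eq_right hst, min_eq_left hst]
    nlinarith [mul_nonneg hs (sub_nonneg.mpr h), mul_nonneg (sub_nonneg.mpr hst)
      (sub_nonneg.mpr hGP)]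
  · rw [max_eq_left hst, min_eq_right hst]
    nlinarith [mul_nonneg ht (sub_nonneg.mpr h), mul_nonneg (sub_nonneg.mpr hst)
      (sub_nonneg.mpr hFP)]

theorem prod_add_prod_le_max_min {κ : Type*} (s : Finset κ) {f g : κ → ℝ} (hf : ∀ i, 0 ≤ f i)
    (hg : ∀ i, 0 ≤ g i) :
    ∏ i ∈ s, f i + ∏ i ∈ s, g i ≤ ∏ i ∈ s, max (f i) (g i) + ∏ i ∈ s, min (f i) (g i) := by
  classical
  induction s using Finset.induction_on with
  | empty => simp
  | insert a s ha ih =>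
    simp only [Finset.prod_insert ha]
    exact mul_add_mul_le_max_min (hf a) (hg a)
      (Finset.prod_le_prod (fun i _ => hf i) fun i _ => le_max_left _ _)
      (Finset.prod_le_prod (fun i _ => hg i) fun i _ => le_max_right _ _) ih

theorem max_pow_add_min_pow (s t : ℝ) (k : ℕ) : max s t ^ k + min s t ^ k = s ^ k + t ^ k := by
  rcases le_total s t with h | h
  · rw [max_eq_right h, min_eq_left h, add_comm]
  · rw [max_eq_left h, min_eq_right h]

variable {κ : Type*} {α : ℝ} {k : ℕ}

theorem armStart_nonneg {s : ℝ} (hs : 0 ≤ s) {A : ℕ → Option κ → ℝ} (hA : ∀ i o, 0 ≤ A i o)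
    (i : ℕ) : 0 ≤ armStart s A i := by
  unfold armStart
  split_ifs
  · exact hs
  · exact hA _ _

/-- Without its first edge an arm is again an arm, starting at the end of that edge; this serves to
split the pendant edge off an arm. -/
theorem armStart_shift (s : ℝ) (A : ℕ → Option κ → ℝ) (i : ℕ) :
    armStart (A 0 none) (fun j => A (j + 1)) i = armStart s A (i + 1) := by
  cases i <;> simp [armStart]

theorem armStart_max (s : ℝ) (a b : ℕ → Option κ → ℝ) (i : ℕ) :
    armStart s (fun i o => max (a i o) (b i o)) i = max (armStart s a i) (armStart s b i) := by
  unfold armStart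
  split_ifs <;> simp

theorem armStart_min (s : ℝ) (a b : ℕ → Option κ → ℝ) (i : ℕ) :
    armStart s (fun i o => min (a i o) (b i o)) i = min (armStart s a i) (armStart s b i) := by
  unfold armStart
  split_ifs <;> simp

theorem edgeForm_lt {ι : Type*} (hα0 : 0 ≤ α) (hα1 : α < 1) (hk : k ≠ 0) {x y : ι → ℝ}
    {s : Finset ι} (hx : ∀ i ∈ s, 0 < x i) (hxy : ∀ i ∈ s, x i ≤ y i) {w : ι} (hw : w ∈ s)
    (hlt : x w < y w) : edgeForm α k x s < edgeForm α k y s := by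
  have h1 : ∑ i ∈ s, x i ^ k ≤ ∑ i ∈ s, y i ^ k :=
    Finset.sum_le_sum fun i hi => pow_le_pow_left₀ (hx i hi).le (hxy i hi) k
  have h2 : ∏ i ∈ s, x i < ∏ i ∈ s, y i := Finset.prod_lt_prod hx hxy ⟨w, hw, hlt⟩
  have h3 : 0 < (1 - α) * k := mul_pos (by linarith) (by positivity)
  exact add_lt_add_of_le_of_lt (mul_le_mul_of_nonneg_left h1 hα0) (mul_lt_mul_of_pos_left h2 h3)

variable [Fintype κ]

theorem starForm_add_le_max_min (hα1 : α ≤ 1) {s t : ℝ} {f g : κ → ℝ}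
    (hs : 0 ≤ s) (ht : 0 ≤ t) (hf : ∀ i, 0 ≤ f i) (hg : ∀ i, 0 ≤ g i) :
    starForm α k s f + starForm α k t g ≤
      starForm α k (max s t) (fun i => max (f i) (g i)) +
        starForm α k (min s t) (fun i => min (f i) (g i)) := by
  have h1 := mul_add_mul_le_max_min hs ht
    (Finset.prod_le_prod (fun i _ => hf i) fun i (_ : i ∈ Finset.univ) => le_max_left (f i) (g i))
    (Finset.prod_le_prod (fun i _ => hg i) fun i _ => le_max_right (f i) (g i))
    (prod_add_prod_le_max_min Finset.univ hf hg)
  have h2 : ∑ i, max (f i) (g i) ^ k + ∑ i, min (f i) (g i) ^ k =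
      ∑ i, f i ^ k + ∑ i, g i ^ k := by
    rw [← Finset.sum_add_distrib, ← Finset.sum_add_distrib]
    exact Finset.sum_congr rfl fun i _ => max_pow_add_min_pow _ _ k
  have h3 := max_pow_add_min_pow s t k
  have h4 : 0 ≤ (1 - α) * k := mul_nonneg (by linarith) (Nat.cast_nonneg k)
  have h5 := mul_le_mul_of_nonneg_left h1 h4
  have h6 : α * (max s t ^ k + ∑ i, max (f i) (g i) ^ k) +
      α * (min s t ^ k + ∑ i, min (f i) (g i) ^ k) =
      α * (s ^ k + ∑ i, f i ^ k) + α * (t ^ k + ∑ i, g i ^ k) := by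
    rw [← mul_add, ← mul_add]
    congr 1
    linarith
  unfold starForm
  linarith

theorem starForm_mono (hα0 : 0 ≤ α) (hα1 : α ≤ 1) {s t : ℝ} {f g : κ → ℝ}
    (hs : 0 ≤ s) (hst : s ≤ t) (hf : ∀ i, 0 ≤ f i) (hfg : ∀ i, f i ≤ g i) :
    starForm α k s f ≤ starForm α k t g := by
  unfold starForm
  have h4 : 0 ≤ (1 - α) * k := mul_nonneg (by linarith) (Nat.cast_nonneg k)
  refine add_le_add (mul_le_mul_of_nonneg_left (add_le_add (pow_le_pow_left₀ hs hst k)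
    (Finset.sum_le_sum fun i _ => pow_le_pow_left₀ (hf i) (hfg i) k)) hα0)
    (mul_le_mul_of_nonneg_left (mul_le_mul hst (Finset.prod_le_prod (fun i _ => hf i)
      fun i _ => hfg i) (Finset.prod_nonneg fun i _ => hf i) (hs.trans hst)) h4)

theorem eq_of_prod_eq_of_le {f g : κ → ℝ} (hf : ∀ i, 0 < f i) (hfg : ∀ i, f i ≤ g i)
    (h : ∏ i, f i = ∏ i, g i) (i : κ) : f i = g i := by
  by_contra hi
  exact (Finset.prod_lt_prod (fun j _ => hf j) (fun j _ => hfg j)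
    ⟨i, Finset.mem_univ i, lt_of_le_of_ne (hfg i) hi⟩).ne h

/-- The first `n` edges of the two arms are paired and gain by supermodularity; on the unpaired
edges of the longer arm monotonicity suffices. -/
theorem arms_le_max_min (hα0 : 0 ≤ α) (hα1 : α ≤ 1) {s : ℝ} (hs : 0 ≤ s)
    {a b : ℕ → Option κ → ℝ} (ha : ∀ i o, 0 ≤ a i o) (hb : ∀ i o, 0 ≤ b i o) {m n : ℕ}
    (hmn : n ≤ m) :
    ∑ i ∈ Finset.range m, starForm α k (armStart s a i) (a i) +
        ∑ i ∈ Finset.range n, starForm α k (armStart s b i) (b i) ≤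
      ∑ i ∈ Finset.range m, starForm α k (armStart s (fun i o => max (a i o) (b i o)) i)
          (fun o => max (a i o) (b i o)) +
        ∑ i ∈ Finset.range n, starForm α k (armStart s (fun i o => min (a i o) (b i o)) i)
          (fun o => min (a i o) (b i o)) := by
  obtain ⟨d, rfl⟩ := Nat.exists_eq_add_of_le hmn
  simp only [Finset.sum_range_add, armStart_max, armStart_min]
  have h1 := Finset.sum_le_sum fun i (_ : i ∈ Finset.range n) =>
    starForm_add_le_max_min (k := k) hα1 (armStart_nonneg hs ha i) (armStart_nonneg hs hb i)
      (ha i) (hb i)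
  have h2 := Finset.sum_le_sum fun i (_ : i ∈ Finset.range d) =>
    starForm_mono (k := k) hα0 hα1 (armStart_nonneg hs ha (n + i))
      (le_max_left _ (armStart s b (n + i))) (ha (n + i)) fun o => le_max_left _ (b (n + i) o)
  simp only [Finset.sum_add_distrib] at h1
  linarith

/-- A pair has the same values after the exchange. On the unpaired edges equality needs `b` to
vanish, so that the maximum is `a`. -/
theorem arms_pow_max_min {a b : ℕ → κ → ℝ} (ha : ∀ i o, 0 ≤ a i o) {m n : ℕ} (hmn : n ≤ m)
    (hb : ∀ i o, n ≤ i → b i o = 0) :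
    ∑ i ∈ Finset.range m, ∑ o, max (a i o) (b i o) ^ k +
        ∑ i ∈ Finset.range n, ∑ o, min (a i o) (b i o) ^ k =
      ∑ i ∈ Finset.range m, ∑ o, a i o ^ k + ∑ i ∈ Finset.range n, ∑ o, b i o ^ k := by
  obtain ⟨d, rfl⟩ := Nat.exists_eq_add_of_le hmn
  simp only [Finset.sum_range_add]
  have h1 : ∀ i ∈ Finset.range n, ∑ o, max (a i o) (b i o) ^ k + ∑ o, min (a i o) (b i o) ^ k =
      ∑ o, a i o ^ k + ∑ o, b i o ^ k := fun i _ => by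
    rw [← Finset.sum_add_distrib, ← Finset.sum_add_distrib]
    exact Finset.sum_congr rfl fun o _ => max_pow_add_min_pow _ _ k
  have h2 : ∀ i ∈ Finset.range d, ∑ o, max (a (n + i) o) (b (n + i) o) ^ k =
      ∑ o, a (n + i) o ^ k := fun i _ => Finset.sum_congr rfl fun o _ => by
    rw [hb _ _ (Nat.le_add_right n i), max_eq_left (ha _ _)]
  have h3 := Finset.sum_congr rfl h1
  simp only [Finset.sum_add_distrib] at h3
  rw [Finset.sum_congr rfl h2]
  linarith

end Polarization

/-! ### Two pendant vertices on one edge -/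

/-- The edge `E e₀` consists of `u`, `v` and the `z c`, without repetitions, and `u` and `v` lie on
no other edge. -/
structure IsPendantPair {ι ε : Type*} [DecidableEq ι] (E : ε → Finset ι) (e₀ : ε) (u v : ι)
    {n : ℕ} (z : Fin n → ι) : Prop where
  edge : E e₀ = insert u (insert v (Finset.univ.image z))
  inj : Function.Injective z
  ne : u ≠ v
  ne_left : ∀ c, z c ≠ u
  ne_right : ∀ c, z c ≠ v
  left : ∀ e, u ∈ E e → e = e₀
  right : ∀ e, v ∈ E e → e = e₀

namespace IsPendantPair

variable {ι ε : Type*} [DecidableEq ι] {E : ε → Finset ι} {e₀ : ε} {u v : ι} {n : ℕ}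
  {z : Fin n → ι}

theorem symm (h : IsPendantPair E e₀ u v z) : IsPendantPair E e₀ v u z where
  edge := by rw [h.edge, Finset.insert_comm]
  inj := h.inj
  ne := h.ne.symm
  ne_left := h.ne_right
  ne_right := h.ne_left
  left := h.right
  right := h.left

theorem notMem_left (h : IsPendantPair E e₀ u v z) : u ∉ insert v (Finset.univ.image z) := by
  simp only [Finset.mem_insert, Finset.mem_image, Finset.mem_univ, true_and, not_or, not_exists]
  exact ⟨h.ne, h.ne_left⟩

theorem notMem_right (h : IsPendantPair E e₀ u v z) : v ∉ Finset.univ.image z := by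
  simp only [Finset.mem_image, Finset.mem_univ, true_and, not_exists]
  exact h.ne_right

theorem prod_eq (h : IsPendantPair E e₀ u v z) {x : ι → ℝ} {f : Option (Fin n) → ℝ}
    (hv : f none = x v) (hz : ∀ c, f (some c) = x (z c)) :
    ∏ i ∈ E e₀, x i = x u * ∏ o, f o := by
  rw [h.edge, Finset.prod_insert h.notMem_left, Finset.prod_insert h.notMem_right,
    Finset.prod_image fun a _ b _ hab => h.inj hab, Fintype.prod_option, hv]
  simp only [hz]

theorem sum_eq (h : IsPendantPair E e₀ u v z) {x : ι → ℝ} {f : Option (Fin n) → ℝ}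
    (hv : f none = x v) (hz : ∀ c, f (some c) = x (z c)) :
    ∑ i ∈ E e₀, x i = x u + ∑ o, f o := by
  rw [h.edge, Finset.sum_insert h.notMem_left, Finset.sum_insert h.notMem_right,
    Finset.sum_image fun a _ b _ hab => h.inj hab, Fintype.sum_option, hv]
  simp only [hz]

variable {α : ℝ} {k : ℕ}

theorem edgeForm_eq (h : IsPendantPair E e₀ u v z) {x : ι → ℝ} {f : Option (Fin n) → ℝ}
    (hv : f none = x v) (hz : ∀ c, f (some c) = x (z c)) :
    edgeForm α k x (E e₀) = starForm α k (x u) f := by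
  rw [edgeForm, starForm, h.prod_eq hv hz,
    h.sum_eq (x := fun i => x i ^ k) (f := fun o => f o ^ k) (by rw [hv]) fun c => by rw [hz]]

theorem edgesAt_left [Fintype ε] (h : IsPendantPair E e₀ u v z) (x : ι → ℝ) :
    edgesAt E α k x u = α * x u ^ k + (1 - α) * ∏ i ∈ E e₀, x i := by
  rw [edgesAt, Finset.sum_eq_single e₀]
  · rw [if_pos (h.edge ▸ Finset.mem_insert_self _ _)]
  · exact fun e _ he => if_neg fun hu => he (h.left e hu)
  · simp

theorem mem_edge (h : IsPendantPair E e₀ u v z) (c : Fin n) : z c ∈ E e₀ := by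
  rw [h.edge]
  exact Finset.mem_insert_of_mem (Finset.mem_insert_of_mem
    (Finset.mem_image_of_mem _ (Finset.mem_univ _)))

theorem exists_of_mem_edge (h : IsPendantPair E e₀ u v z) {w : ι} (hw : w ∈ E e₀) (hu : w ≠ u)
    (hv : w ≠ v) : ∃ c, z c = w := by
  rw [h.edge] at hw
  simpa [hu, hv] using hw

end IsPendantPair

/-! ### Two attached paths and the strict comparison of the maxima -/

section TwoArms

variable {ι ε : Type*} [DecidableEq ι] {E : ε → Finset ι} {e₀ : ε} {k : ℕ} {u v : ι} {p q : ℕ}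

/-- The edges of a hypergraph with edges `E` after attaching at `u` a loose path of `p` edges and
at `v` one of `q` edges. -/
def twoArms (E : ε → Finset ι) (k : ℕ) (u v : ι) (p q : ℕ) :
    (ε ⊕ Fin p) ⊕ Fin q → Finset ((ι ⊕ PathVertex k p) ⊕ PathVertex k q) :=
  attachEdges (attachEdges E k u p) k (Sum.inl v) q

/-- The vector with values `g` on the original vertices, and `A` and `B` on the attached paths. -/
def armsVector (k p q : ℕ) (g : ι → ℝ) (A B : ℕ → Option (Fin (k - 2)) → ℝ) :
    (ι ⊕ PathVertex k p) ⊕ PathVertex k q → ℝ :=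
  Sum.elim (Sum.elim g fun c => A c.1 c.2) fun c => B c.1 c.2

variable {g : ι → ℝ} {A B : ℕ → Option (Fin (k - 2)) → ℝ} {α : ℝ}

omit [DecidableEq ι] in
-- Padding with zeros past the ends lets arms of different lengths be compared index by index.
theorem exists_eq_armsVector {x : (ι ⊕ PathVertex k p) ⊕ PathVertex k q → ℝ}
    (hx : ∀ i, 0 < x i) : ∃ g A B, x = armsVector k p q g A B ∧ (∀ i, 0 < g i) ∧
      (∀ i o, i < p → 0 < A i o) ∧ (∀ i o, p ≤ i → A i o = 0) ∧
      (∀ i o, i < q → 0 < B i o) ∧ (∀ i o, q ≤ i → B i o = 0) := by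
  refine ⟨fun i => x (Sum.inl (Sum.inl i)),
    fun i o => if h : i < p then x (Sum.inl (Sum.inr (⟨i, h⟩, o))) else 0,
    fun i o => if h : i < q then x (Sum.inr (⟨i, h⟩, o)) else 0, ?_, fun i => hx _, ?_, ?_, ?_, ?_⟩
  · funext c
    rcases c with (i | ⟨i, o⟩) | ⟨i, o⟩ <;> simp [armsVector]
  · intro i o hi
    simpa only [dif_pos hi] using hx _
  · intro i o hi
    simp only [dif_neg hi.not_gt]
  · intro i o hi
    simpa only [dif_pos hi] using hx _
  · intro i o hi
    simp only [dif_neg hi.not_gt]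

theorem edgesForm_twoArms [Fintype ε] :
    edgesForm (twoArms E k u v p q) α k (armsVector k p q g A B) = edgesForm E α k g +
      ∑ i ∈ Finset.range p, starForm α k (armStart (g u) A i) (A i) +
      ∑ i ∈ Finset.range q, starForm α k (armStart (g v) B i) (B i) := by
  rw [twoArms, edgesForm_attachEdges (g := Sum.elim g fun c => A c.1 c.2) (A := B)
    (fun _ => rfl) fun _ _ => rfl, edgesForm_attachEdges (g := g) (A := A)
    (fun _ => rfl) fun _ _ => rfl]
  rfl

omit [DecidableEq ι] in
theorem sum_pow_armsVector [Fintype ι] :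
    ∑ i, armsVector k p q g A B i ^ k = ∑ i, g i ^ k +
      ∑ i ∈ Finset.range p, ∑ o, A i o ^ k + ∑ i ∈ Finset.range q, ∑ o, B i o ^ k := by
  rw [sum_pow_attachEdges (g := Sum.elim g fun c => A c.1 c.2) (A := B)
    (fun _ => rfl) fun _ _ => rfl, sum_pow_attachEdges (g := g) (A := A)
    (fun _ => rfl) fun _ _ => rfl]

section Equations

variable [Fintype ε]

theorem edgesAt_twoArms_base {w : ι} (hu : w ≠ u) (hv : w ≠ v) :
    edgesAt (twoArms E k u v p q) α k (armsVector k p q g A B) (Sum.inl (Sum.inl w)) =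
      edgesAt E α k g w := by
  rw [twoArms, edgesAt_attachEdges_inl (g := Sum.elim g fun c => A c.1 c.2) (A := B)
    (fun _ => rfl) fun _ _ => rfl, edgesAt_attachEdges_inl (g := g) (A := A)
    (fun _ => rfl) fun _ _ => rfl, if_neg fun h => hu h.1,
    if_neg fun h => hv (Sum.inl_injective h.1), add_zero, add_zero]

theorem edgesAt_twoArms_left (huv : u ≠ v) :
    edgesAt (twoArms E k u v p q) α k (armsVector k p q g A B) (Sum.inl (Sum.inl u)) =
      edgesAt E α k g u +
        if 0 < p then α * g u ^ k + (1 - α) * (g u * ∏ o, A 0 o) else 0 := by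
  rw [twoArms, edgesAt_attachEdges_inl (g := Sum.elim g fun c => A c.1 c.2) (A := B)
    (fun _ => rfl) fun _ _ => rfl, edgesAt_attachEdges_inl (g := g) (A := A)
    (fun _ => rfl) fun _ _ => rfl, if_neg (c := Sum.inl u = Sum.inl v ∧ _)
    fun h => huv (Sum.inl_injective h.1), add_zero]
  simp only [true_and]

theorem edgesAt_twoArms_right (huv : u ≠ v) :
    edgesAt (twoArms E k u v p q) α k (armsVector k p q g A B) (Sum.inl (Sum.inl v)) =
      edgesAt E α k g v +
        if 0 < q then α * g v ^ k + (1 - α) * (g v * ∏ o, B 0 o) else 0 := by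
  rw [twoArms, edgesAt_attachEdges_inl (g := Sum.elim g fun c => A c.1 c.2) (A := B)
    (fun _ => rfl) fun _ _ => rfl, edgesAt_attachEdges_inl (g := g) (A := A)
    (fun _ => rfl) fun _ _ => rfl, if_neg (c := v = u ∧ _) fun h => huv h.1.symm, add_zero]
  simp only [true_and, Sum.elim_inl]

theorem edgesAt_twoArms_left_path (i : ℕ) (hi : i < p) :
    edgesAt (twoArms E k u v p q) α k (armsVector k p q g A B)
        (Sum.inl (Sum.inr (⟨i, hi⟩, none))) =
      (α * A i none ^ k + (1 - α) * (armStart (g u) A i * ∏ o, A i o)) +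
      if i + 1 < p then
        α * A i none ^ k + (1 - α) * (A i none * ∏ o, A (i + 1) o) else 0 := by
  rw [twoArms, edgesAt_attachEdges_inl (g := Sum.elim g fun c => A c.1 c.2) (A := B)
    (fun _ => rfl) fun _ _ => rfl, edgesAt_attachEdges_inr (g := g) (A := A)
    (fun _ => rfl) fun _ _ => rfl, if_neg (c := Sum.inr _ = Sum.inl v ∧ _) fun h => by
      simp at h, add_zero]

theorem edgesAt_twoArms_right_path (i : ℕ) (hi : i < q) :
    edgesAt (twoArms E k u v p q) α k (armsVector k p q g A B)
        (Sum.inr (⟨i, hi⟩, none)) =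
      (α * B i none ^ k + (1 - α) * (armStart (g v) B i * ∏ o, B i o)) +
      if i + 1 < q then
        α * B i none ^ k + (1 - α) * (B i none * ∏ o, B (i + 1) o) else 0 := by
  rw [twoArms, edgesAt_attachEdges_inr (g := Sum.elim g fun c => A c.1 c.2) (A := B)
    (fun _ => rfl) fun _ _ => rfl]
  rfl

end Equations

theorem card_twoArms (hk : 2 ≤ k) (hE : ∀ e, (E e).card = k) (e : (ε ⊕ Fin p) ⊕ Fin q) :
    (twoArms E k u v p q e).card = k :=
  card_attachEdges hk (card_attachEdges hk hE) e

variable [Fintype ι] [Fintype ε]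

/-- If the form of the hypergraph with paths of `p + 1` and `r` edges attains its bound `c`, then
every bound `c'` of the form of the one with paths of `p` and `r + 1` edges is greater. The two
paths are compared by polarization: with respect to the reflection at `u`, the larger one of two
values is moved to the side that carries the rest of the hypergraph. -/
theorem lt_of_isFormBound_twoArms (hk : 3 ≤ k) (hE : ∀ e, (E e).card = k)
    (hconn : EdgesConnected E) {z : Fin (k - 2) → ι} (hpair : IsPendantPair E e₀ u v z)
    {c₀ : Fin (k - 2)} {f₀ : ε} (hf₀ : f₀ ≠ e₀) (hc₀ : z c₀ ∈ E f₀) (hα0 : 0 ≤ α) (hα1 : α < 1)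
    {r : ℕ} (hr : r < p) {c c' : ℝ} (hc : IsFormBound (twoArms E k u v (p + 1) r) α k c)
    {x : (ι ⊕ PathVertex k (p + 1)) ⊕ PathVertex k r → ℝ} (hx : ∀ i, 0 ≤ x i) (hx0 : x ≠ 0)
    (hxc : edgesForm (twoArms E k u v (p + 1) r) α k x = c * ∑ i, x i ^ k)
    (hc' : IsFormBound (twoArms E k u v p (r + 1)) α k c') : c < c' := by
  classical
  by_contra! hcc
  have hnew : IsFormBound (twoArms E k u v p (r + 1)) α k c := fun y hy =>
    (hc' y hy).trans (mul_le_mul_of_nonneg_right hcc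
      (Finset.sum_nonneg fun i _ => pow_nonneg (hy i) k))
  have hxpos := hc.pos (card_twoArms (by omega) hE)
    ((hconn.attachEdges u (p + 1)).attachEdges (Sum.inl v) r) hα0 hα1 hx hx0 hxc
  obtain ⟨g, a, b', rfl, hg, ha, ha0, hb', hb0'⟩ := exists_eq_armsVector hxpos
  set s : ℝ := g u with hs
  -- The second arm from `u`: its edge `0` is `E e₀`, which ends at `v`, and the path at `v`
  -- follows, shifted by one.
  obtain ⟨b, hbv, hbz, hbs⟩ : ∃ b : ℕ → Option (Fin (k - 2)) → ℝ, b 0 none = g v ∧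
      (∀ c, b 0 (some c) = g (z c)) ∧ ∀ j, b (j + 1) = b' j :=
    ⟨fun j => Nat.casesOn j (fun o => o.elim (g v) fun c => g (z c)) fun j => b' j,
      rfl, fun _ => rfl, fun _ => rfl⟩
  have hbpos : ∀ j o, j ≤ r → 0 < b j o := by
    rintro (_ | j) o hj
    · rcases o with _ | c
      · exact hbv ▸ hg v
      · exact hbz c ▸ hg (z c)
    · exact hbs j ▸ hb' j o hj
  have hb0 : ∀ j o, r + 1 ≤ j → b j o = 0 := by
    rintro (_ | j) o hj
    · omega
    · exact hbs j ▸ hb0' j o (by omega)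
  have hbnn : ∀ j o, 0 ≤ b j o := fun j o => by
    rcases le_or_gt j r with h | h
    · exact (hbpos j o h).le
    · exact (hb0 j o h).ge
  have hann : ∀ j o, 0 ≤ a j o := fun j o => by
    rcases lt_or_ge j (p + 1) with h | h
    · exact (ha j o h).le
    · exact (ha0 j o h).ge
  set M : ℕ → Option (Fin (k - 2)) → ℝ := fun i o => max (a i o) (b i o) with hM
  set m : ℕ → Option (Fin (k - 2)) → ℝ := fun i o => min (a i o) (b i o) with hm
  have hbM : ∀ i o, b i o ≤ M i o := fun i o => le_max_right _ _
  have hMpos : ∀ i o, i ≤ p → 0 < M i o := fun i o hi =>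
    lt_max_of_lt_left (ha i o (by omega))
  have hspos : 0 < s := hg u
  -- The reflected base values: `v` receives the value `s` of the common start, and `u` becomes the
  -- end of edge `0` of the arm `M`.
  obtain ⟨g', hg'u, hg'v, hg'z, hg'o⟩ : ∃ g' : ι → ℝ, g' u = M 0 none ∧ g' v = s ∧
      (∀ c, g' (z c) = M 0 (some c)) ∧ ∀ i, i ∉ E e₀ → g' i = g i := by
    refine ⟨fun i => if i = u then M 0 none else if i = v then s else
      Function.extend z (fun c => M 0 (some c)) g i, ?_, ?_, fun c => ?_, fun i hi => ?_⟩
    · simp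
    · simp [hpair.ne.symm]
    · simp [hpair.ne_left, hpair.ne_right, hpair.inj.extend_apply]
    · rw [hpair.edge] at hi
      simp only [Finset.mem_insert, Finset.mem_image, Finset.mem_univ, true_and, not_or] at hi
      simp only [if_neg hi.1, if_neg hi.2.1]
      exact Function.extend_apply' _ _ _ hi.2.2
  have hgg' : ∀ i, i ≠ u → i ≠ v → g i ≤ g' i := fun i hiu hiv => by
    by_cases hi : i ∈ E e₀
    · obtain ⟨c, rfl⟩ := hpair.exists_of_mem_edge hi hiu hiv
      rw [hg'z, ← hbz]
      exact hbM 0 _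
    · exact (hg'o i hi).ge
  have hother : ∀ f, f ≠ e₀ → ∀ i ∈ E f, g i ≤ g' i := fun f hf i hi =>
    hgg' i (fun h => hf (hpair.left f (h ▸ hi))) fun h => hf (hpair.right f (h ▸ hi))
  set y := armsVector k p (r + 1) g' (fun i => M (i + 1)) m with hy
  have hmnn : ∀ i o, 0 ≤ m i o := fun i o => le_min (hann i o) (hbnn i o)
  have hg'nn : ∀ i, 0 ≤ g' i := fun i => by
    by_cases hiu : i = u
    · rw [hiu, hg'u]; exact (hMpos 0 _ (Nat.zero_le _)).le
    · by_cases hiv : i = v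
      · rw [hiv, hg'v]; exact hspos.le
      · exact (hg i).le.trans (hgg' i hiu hiv)
  have hynn : ∀ i, 0 ≤ y i := by
    rintro ((i | ⟨i, o⟩) | ⟨i, o⟩)
    · exact hg'nn i
    · exact (hbnn _ o).trans (hbM _ o)
    · exact hmnn _ o
  have hstart : ∀ j, armStart (g v) b' j = armStart s b (j + 1) := fun j => by
    have : b' = fun j => b (j + 1) := funext fun j => (hbs j).symm
    rw [this, ← hbv, armStart_shift s b]
  set R : (ι → ℝ) → ℝ := fun h => ∑ f ∈ Finset.univ.erase e₀, edgeForm α k h (E f) with hR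
  have hold : edgesForm (twoArms E k u v (p + 1) r) α k (armsVector k (p + 1) r g a b') =
      R g + (∑ i ∈ Finset.range (p + 1), starForm α k (armStart s a i) (a i) +
        ∑ i ∈ Finset.range (r + 1), starForm α k (armStart s b i) (b i)) := by
    rw [edgesForm_twoArms, edgesForm, ← Finset.add_sum_erase _ _ (Finset.mem_univ e₀),
      hpair.edgeForm_eq hbv hbz, Finset.sum_range_succ' (fun i => starForm α k (armStart s b i) _)]
    simp only [hstart, hbs]
    simp only [armStart, hR, if_true]
    ring
  -- The edge `E e₀` is now read from `v`; with the `p` edges at `u` it forms the arm `M` of `p + 1`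
  -- edges.
  have hform : edgesForm (twoArms E k u v p (r + 1)) α k y =
      R g' + (∑ i ∈ Finset.range (p + 1), starForm α k (armStart s M i) (M i) +
        ∑ i ∈ Finset.range (r + 1), starForm α k (armStart s m i) (m i)) := by
    rw [hy, edgesForm_twoArms, edgesForm, ← Finset.add_sum_erase _ _ (Finset.mem_univ e₀),
      hpair.symm.edgeForm_eq hg'u.symm fun c => (hg'z c).symm,
      Finset.sum_range_succ' (fun i => starForm α k (armStart s M i) _)]
    simp only [hg'u, hg'v, armStart_shift s M]
    simp only [hR]
    rw [show armStart s M 0 = s from rfl]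
    ring
  have hRle : R g ≤ R g' := Finset.sum_le_sum fun f hf =>
    edgeForm_mono hα0 hα1.le (fun i _ => (hg i).le) (hother f (Finset.ne_of_mem_erase hf))
  have harms := arms_le_max_min (k := k) hα0 hα1.le hspos.le hann hbnn (show r + 1 ≤ p + 1 by omega)
  have hsplit : ∀ h : ι → ℝ, ∑ i, h i = ∑ i ∈ (E e₀)ᶜ, h i + ∑ i ∈ E e₀, h i := fun h =>
    (Finset.sum_compl_add_sum _ _).symm
  have hnorm : ∑ i, y i ^ k = ∑ i, armsVector k (p + 1) r g a b' i ^ k := by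
    have h1 := arms_pow_max_min (k := k) hann (show r + 1 ≤ p + 1 by omega) hb0
    rw [Finset.sum_range_succ' (fun i => ∑ o, b i o ^ k),
      Finset.sum_range_succ' (fun i => ∑ o, max (a i o) (b i o) ^ k)] at h1
    rw [hy, sum_pow_armsVector, sum_pow_armsVector, hsplit (fun i => g i ^ k),
      hsplit (fun i => g' i ^ k),
      hpair.sum_eq (x := fun i => g i ^ k) (f := fun o => b 0 o ^ k) (by rw [hbv])
        (fun c => by rw [hbz]),
      hpair.symm.sum_eq (x := fun i => g' i ^ k) (f := fun o => M 0 o ^ k) (by rw [hg'u])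
        (fun c => by rw [hg'z]),
      Finset.sum_congr rfl fun i hi => by rw [hg'o i (Finset.mem_compl.mp hi)]]
    simp only [hg'v, ← hbs]
    simp only [hM, hm]
    linarith
  have hyle := hnew y hynn
  have hyc : edgesForm (twoArms E k u v p (r + 1)) α k y = c * ∑ i, y i ^ k := by
    refine le_antisymm hyle ?_
    rw [hnorm, ← hxc, hold, hform]
    exact add_le_add hRle harms
  have hReq : R g = R g' := by
    refine le_antisymm hRle ?_
    rw [hnorm, ← hxc, hold, hform] at hyc
    linarith
  have hk0 : k ≠ 0 := by omega
  -- A larger value at `z c₀` would strictly increase the contribution of `f₀`, as all values of `g`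
  -- are positive.
  have hw : g (z c₀) = g' (z c₀) := by
    by_contra hne
    refine (edgeForm_lt hα0 hα1 hk0 (fun i _ => hg i) (hother f₀ hf₀) hc₀
      (lt_of_le_of_ne (hother f₀ hf₀ _ hc₀) hne)).ne ?_
    exact (Finset.sum_eq_sum_iff_of_le fun f hf => edgeForm_mono hα0 hα1.le
      (fun i _ => (hg i).le) (hother f (Finset.ne_of_mem_erase hf))).mp hReq f₀
      (Finset.mem_erase.mpr ⟨hf₀, Finset.mem_univ _⟩)
  have hk2 : 2 ≤ k := by omega
  have eqx : ∀ i, _ = edgesAt _ _ _ _ i := hc.mul_pow_eq hk2 hα1.le hx hxc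
  have eqy : ∀ i, _ = edgesAt _ _ _ _ i := hnew.mul_pow_eq hk2 hα1.le hynn hyc
  have hprod0 : ∏ i ∈ E e₀, g i = s * ∏ o, b 0 o := hpair.prod_eq hbv hbz
  have hprod0' : ∏ i ∈ E e₀, g' i = s * ∏ o, M 0 o := by
    rw [hpair.symm.prod_eq hg'u.symm fun c => (hg'z c).symm, hg'v]
  have hprodle : ∀ j, j ≤ r → ∏ o, b j o ≤ ∏ o, M j o := fun j _ =>
    Finset.prod_le_prod (fun o _ => hbnn j o) fun o _ => hbM j o
  have hα : 0 < 1 - α := by linarith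
  -- Both eigenvalue equations at `z c₀` have the same left side, and the old terms are at most the
  -- new ones, so the terms of `E e₀` agree.
  have hbase : ∀ o, b 0 o = M 0 o := by
    have h1 := eqx (Sum.inl (Sum.inl (z c₀)))
    have h2 := eqy (Sum.inl (Sum.inl (z c₀)))
    rw [edgesAt_twoArms_base (hpair.ne_left c₀) (hpair.ne_right c₀)] at h1 h2
    have h3 : edgesAt E α k g (z c₀) = edgesAt E α k g' (z c₀) := by
      rw [← h1, ← h2]
      change c * g (z c₀) ^ k = c * g' (z c₀) ^ k
      rw [hw]
    unfold edgesAt at h3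
    have h4 := (Finset.sum_eq_sum_iff_of_le fun f _ => ?_).mp h3 e₀ (Finset.mem_univ _)
    · rw [if_pos (hpair.mem_edge c₀), if_pos (hpair.mem_edge c₀), hw, hprod0, hprod0'] at h4
      have h5 := mul_left_cancel₀ hspos.ne' (mul_left_cancel₀ hα.ne' (add_left_cancel h4))
      exact eq_of_prod_eq_of_le (fun o => hbpos 0 o (Nat.zero_le _)) (hbM 0) h5
    · split_ifs
      · rw [hw]
        refine add_le_add le_rfl (mul_le_mul_of_nonneg_left ?_ hα.le)
        by_cases hf : f = e₀
        · rw [hf, hprod0, hprod0']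
          exact mul_le_mul_of_nonneg_left (hprodle 0 (Nat.zero_le _)) hspos.le
        · exact Finset.prod_le_prod (fun i _ => (hg i).le) (hother f hf)
      · exact le_rfl
  have oldEq : ∀ j, j ≤ r → c * b j none ^ k =
      (α * b j none ^ k + (1 - α) * (armStart s b j * ∏ o, b j o)) +
        if j < r then α * b j none ^ k + (1 - α) * (b j none * ∏ o, b (j + 1) o) else 0 := by
    rintro (_ | j) hj
    · have h1 := eqx (Sum.inl (Sum.inl v))
      rw [edgesAt_twoArms_right hpair.ne, hpair.symm.edgesAt_left, hprod0, ← hbv, ← hbs] at h1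
      rw [show armStart s b 0 = s from rfl, ← h1, hbv]
      rfl
    · have h1 := eqx (Sum.inr (⟨j, hj⟩, none))
      rw [edgesAt_twoArms_right_path j hj, hstart, ← hbs, ← hbs] at h1
      rw [← h1, hbs]
      rfl
  have newEq : ∀ j, j ≤ r → c * M j none ^ k =
      (α * M j none ^ k + (1 - α) * (armStart s M j * ∏ o, M j o)) +
        (α * M j none ^ k + (1 - α) * (M j none * ∏ o, M (j + 1) o)) := by
    rintro (_ | j) hj
    · have h1 := eqy (Sum.inl (Sum.inl u))
      rw [edgesAt_twoArms_left hpair.ne, hpair.edgesAt_left, hprod0', hg'u,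
        if_pos (by omega)] at h1
      rw [show armStart s M 0 = s from rfl, ← h1, ← hg'u]
      rfl
    · have h1 := eqy (Sum.inl (Sum.inr (⟨j, by omega⟩, none)))
      rw [edgesAt_twoArms_left_path j (by omega), hg'u, armStart_shift s M,
        if_pos (by omega)] at h1
      rw [← h1]
      rfl
  -- At the end of edge `j` the left sides agree by induction, so neither of the two edge terms may
  -- grow; the second gives equality on edge `j + 1`.
  have hall : ∀ j, j ≤ r → ∀ o, b j o = M j o := by
    intro j
    induction j with
    | zero => exact fun _ => hbase
    | succ j ih =>
      intro hj
      have hjr : j ≤ r := by omega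
      have h1 := oldEq j hjr
      rw [if_pos (by omega), ih hjr none, newEq j hjr] at h1
      have h2 : armStart s b j * ∏ o, b j o ≤ armStart s M j * ∏ o, M j o := by
        refine mul_le_mul ?_ (hprodle j hjr) (Finset.prod_nonneg fun o _ => hbnn j o)
          (armStart_nonneg hspos.le (fun i o => (hbnn i o).trans (hbM i o)) j)
        rw [hM, armStart_max]
        exact le_max_right _ _
      have hMj := hMpos j none (by omega)
      have h3 := mul_le_mul_of_nonneg_left h2 hα.le
      have h4 := mul_le_mul_of_nonneg_left
        (mul_le_mul_of_nonneg_left (hprodle (j + 1) hj) hMj.le) hα.le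
      have h5 : (1 - α) * (M j none * ∏ o, b (j + 1) o) =
          (1 - α) * (M j none * ∏ o, M (j + 1) o) := by linarith
      exact eq_of_prod_eq_of_le (fun o => hbpos _ o hj) (hbM _)
        (mul_left_cancel₀ hMj.ne' (mul_left_cancel₀ hα.ne' h5))
  -- The old arm ends here, while the arm `M` continues with edge `r + 1 ≤ p`, where it is positive.
  have h1 := oldEq r le_rfl
  rw [if_neg (lt_irrefl r), add_zero, hall r le_rfl none, newEq r le_rfl] at h1
  have h2 : armStart s b r * ∏ o, b r o ≤ armStart s M r * ∏ o, M r o := by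
    refine mul_le_mul ?_ (hprodle r le_rfl) (Finset.prod_nonneg fun o _ => hbnn r o)
      (armStart_nonneg hspos.le (fun i o => (hbnn i o).trans (hbM i o)) r)
    rw [hM, armStart_max]
    exact le_max_right _ _
  have hMr := hMpos r none hr.le
  have h3 := mul_le_mul_of_nonneg_left h2 hα.le
  have h4 : 0 < (1 - α) * (M r none * ∏ o, M (r + 1) o) :=
    mul_pos hα (mul_pos hMr (Finset.prod_pos fun o _ => hMpos (r + 1) o hr))
  have h5 : 0 ≤ α * M r none ^ k := mul_nonneg hα0 (pow_nonneg hMr.le k)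
  linarith

end TwoArms

/-! ### Edges of a finite hypergraph as finite sets -/

namespace Hypergraph

variable {V : Type*} (G : Hypergraph V)

open Classical in
/-- The edges of a hypergraph with finitely many vertices as finite sets of vertices. -/
noncomputable def edgeFinsets [Fintype G.vertexSet] (e : G.edgeSet) : Finset G.vertexSet :=
  Finset.univ.filter fun i => (i : V) ∈ (e : Set V)

variable {G} [Fintype G.vertexSet]

theorem mem_edgeFinsets {e : G.edgeSet} {i : G.vertexSet} :
    i ∈ G.edgeFinsets e ↔ (i : V) ∈ (e : Set V) := by
  simp [edgeFinsets]

theorem image_edgeFinsets (e : G.edgeSet) :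
    Subtype.val '' (G.edgeFinsets e : Set G.vertexSet) = (e : Set V) := by
  ext x
  simp only [Set.mem_image, Finset.mem_coe, mem_edgeFinsets]
  exact ⟨fun ⟨i, hi, hx⟩ => hx ▸ hi,
    fun hx => ⟨⟨x, G.subset_vertexSet_of_mem_edgeSet' e.2 hx⟩, hx, rfl⟩⟩

theorem represents_edgeFinsets : Represents G Subtype.val G.edgeFinsets where
  inj := Subtype.val_injective
  range_eq := Subtype.range_coe
  edge_inj e f h := Subtype.ext (by rw [← image_edgeFinsets e, h, image_edgeFinsets f])
  edges := by
    simp only [image_edgeFinsets]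
    exact Subtype.range_coe

theorem card_edgeFinsets {k : ℕ} (hG : G.IsUniform k) (e : G.edgeSet) :
    (G.edgeFinsets e).card = k := by
  rw [← hG e e.2, ← image_edgeFinsets e, Set.ncard_image_of_injective _ Subtype.val_injective,
    Set.ncard_coe_finset]

theorem edgesConnected_edgeFinsets (hG : G.IsConnected) : EdgesConnected G.edgeFinsets := by
  rintro S ⟨a, ha⟩ hS b
  have key : ∀ y, Relation.ReflTransGen G.Adj (a : V) y → ∃ i ∈ S, (i : V) = y := by
    intro y hy
    induction hy with
    | refl => exact ⟨a, ha, rfl⟩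
    | tail _ hadj ih =>
      obtain ⟨i, hi, rfl⟩ := ih
      obtain ⟨e, he, hie, hye⟩ := hadj
      refine ⟨⟨_, G.subset_vertexSet_of_mem_edgeSet' he hye⟩, ?_, rfl⟩
      exact hS ⟨e, he⟩ i (mem_edgeFinsets.mpr hie) hi _ (mem_edgeFinsets.mpr hye)
  obtain ⟨i, hi, hib⟩ := key b (hG.2 a a.2 b b.2)
  rwa [← Subtype.ext hib]

open Classical in
theorem exists_isPendantPair {k : ℕ} (hk : 2 ≤ k) (hG : G.IsUniform k) {e : G.edgeSet}
    {u v : G.vertexSet} (hue : (u : V) ∈ (e : Set V)) (hve : (v : V) ∈ (e : Set V)) (huv : u ≠ v)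
    (hu : G.degree u = 1) (hv : G.degree v = 1) :
    ∃ z : Fin (k - 2) → G.vertexSet, IsPendantPair G.edgeFinsets e u v z := by
  have hunique : ∀ w : G.vertexSet, (w : V) ∈ (e : Set V) → G.degree w = 1 →
      ∀ f, w ∈ G.edgeFinsets f → f = e := by
    intro w hwe hw f hwf
    obtain ⟨e', he'⟩ := Set.ncard_eq_one.mp hw
    have h1 : (e : Set V) ∈ {e ∈ G.edgeSet | (w : V) ∈ e} := ⟨e.2, hwe⟩
    have h2 : (f : Set V) ∈ {e ∈ G.edgeSet | (w : V) ∈ e} := ⟨f.2, mem_edgeFinsets.mp hwf⟩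
    rw [he'] at h1 h2
    exact Subtype.ext (h2.trans h1.symm)
  have hue' : u ∈ G.edgeFinsets e := mem_edgeFinsets.mpr hue
  have hve' : v ∈ (G.edgeFinsets e).erase u :=
    Finset.mem_erase.mpr ⟨huv.symm, mem_edgeFinsets.mpr hve⟩
  have hcard : (((G.edgeFinsets e).erase u).erase v).card = k - 2 := by
    rw [Finset.card_erase_of_mem hve', Finset.card_erase_of_mem hue', card_edgeFinsets hG]
    omega
  obtain ⟨σ⟩ : Nonempty (Fin (k - 2) ≃ ((G.edgeFinsets e).erase u).erase v) :=
    ⟨(Fintype.equivFinOfCardEq ((Fintype.card_coe _).trans hcard)).symm⟩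
  have himage : Finset.univ.image (fun c => (σ c : G.vertexSet)) =
      ((G.edgeFinsets e).erase u).erase v := by
    ext w
    simp only [Finset.mem_image, Finset.mem_univ, true_and]
    exact ⟨fun ⟨c, hc⟩ => hc ▸ (σ c).2, fun hw => ⟨σ.symm ⟨w, hw⟩, by simp⟩⟩
  refine ⟨fun c => σ c, ?_, ?_, huv, fun c => ?_, fun c => ?_, hunique u hue hu, hunique v hve hv⟩
  · rw [himage, Finset.insert_erase hve', Finset.insert_erase hue']
  · exact Subtype.val_injective.comp σ.injective
  · exact Finset.ne_of_mem_erase (Finset.mem_of_mem_erase (σ c).2)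
  · exact Finset.ne_of_mem_erase (σ c).2

/-- In a connected uniform hypergraph with two edges every edge meets another one. -/
theorem exists_ne_edge_inter {k : ℕ} (hk : k ≠ 0) (hG : G.IsUniform k) (hconn : G.IsConnected)
    (hedges : G.edgeSet.Nontrivial) (e : G.edgeSet) :
    ∃ f : G.edgeSet, f ≠ e ∧ ∃ w ∈ G.edgeFinsets e, w ∈ G.edgeFinsets f := by
  by_contra! hcon
  obtain ⟨f, hf, hfe⟩ := hedges.exists_ne (e : Set V)
  have hne : ∀ g : G.edgeSet, (G.edgeFinsets g).Nonempty := fun g => by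
    rw [← Finset.card_pos, card_edgeFinsets hG]
    omega
  obtain ⟨a, ha⟩ := hne e
  obtain ⟨b, hb⟩ := hne ⟨f, hf⟩
  refine hcon ⟨f, hf⟩ (fun h => hfe (congrArg Subtype.val h)) b ?_ hb
  refine edgesConnected_edgeFinsets hconn {w | w ∈ G.edgeFinsets e} ⟨a, ha⟩ ?_ b
  intro g i hig hie j hj
  by_cases hge : g = e
  · exact hge ▸ hj
  · exact absurd hig (hcon g hge i hie)

end Hypergraph

/-! ### The comparison of spectral radii -/

theorem mainTheorem2 {V : Type*} {k : ℕ} (hk : 3 ≤ k) (G : Hypergraph V)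
    (hfin : G.vertexSet.Finite) (hunif : G.IsUniform k) (hconn : G.IsConnected)
    (hedges : G.edgeSet.Nontrivial)
    {e : Set V} (he : G.IsPendantEdge e) {u v : V} (hue : u ∈ e) (hve : v ∈ e) (huv : u ≠ v)
    (hu : G.IsPendantVertex u) (hv : G.IsPendantVertex v)
    {α : ℝ} (hα0 : 0 ≤ α) (hα1 : α < 1) {p q : ℕ} (hq : 1 ≤ q) (hpq : q ≤ p) :
    (G.attachPaths k u v (p + 1) (q - 1)).alphaSpectralRadius k α <
      (G.attachPaths k u v p q).alphaSpectralRadius k α := by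
  classical
  have : Fintype G.vertexSet := hfin.fintype
  have : Finite G.edgeSet := Finite.of_injective _ (represents_edgeFinsets (G := G)).edge_inj
  have : Fintype G.edgeSet := Fintype.ofFinite _
  obtain ⟨r, rfl⟩ : ∃ r, q = r + 1 := ⟨q - 1, by omega⟩
  rw [Nat.add_sub_cancel]
  lift u to G.vertexSet using hu.1
  lift v to G.vertexSet using hv.1
  lift e to G.edgeSet using he.1
  obtain ⟨z, hz⟩ := exists_isPendantPair (by omega) hunif hue hve
    (fun h => huv (congrArg Subtype.val h)) hu.2 hv.2
  obtain ⟨f, hfe, w, hwe, hwf⟩ := exists_ne_edge_inter (by omega) hunif hconn hedges e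
  -- The vertex shared with a second edge is neither `u` nor `v`, since these lie on `e` only.
  obtain ⟨c₀, rfl⟩ := hz.exists_of_mem_edge hwe (fun h => hfe (hz.left f (h ▸ hwf)))
    fun h => hfe (hz.right f (h ▸ hwf))
  have hrep : ∀ m n, Represents (G.attachPaths k u v m n) (Sum.map (Sum.map Subtype.val id) id)
      (twoArms G.edgeFinsets k u v m n) := fun m n =>
    (represents_edgeFinsets.attachPath hk u m).attachPath hk (Sum.inl v) n
  have hcard : ∀ m n e, (twoArms G.edgeFinsets k u v m n e).card = k := fun m n =>
    card_twoArms (by omega) (card_edgeFinsets hunif)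
  have : Nonempty G.vertexSet := ⟨u⟩
  obtain ⟨c, hc0, hc, x, hx, hx0, hxc⟩ :=
    exists_isFormBound (by omega) (hcard (p + 1) r) hα0 hα1.le
  obtain ⟨c', hc0', hc', y, hy, hy0, hyc⟩ :=
    exists_isFormBound (by omega) (hcard p (r + 1)) hα0 hα1.le
  rw [(hrep (p + 1) r).alphaSpectralRadius_eq (by omega) (hcard _ _) hα0 hα1.le hc0 hc hx hx0 hxc,
    (hrep p (r + 1)).alphaSpectralRadius_eq (by omega) (hcard _ _) hα0 hα1.le hc0' hc' hy hy0 hyc]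
  have hlt := lt_of_isFormBound_twoArms hk (card_edgeFinsets hunif)
    (edgesConnected_edgeFinsets hconn) hz hfe hwf hα0 hα1 hpq hc hx hx0 hxc hc'
  exact (ENNReal.ofReal_lt_ofReal_iff (hc0.trans_lt hlt)).mpr hlt
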